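/- Let $d_l\ge 2$, $d_r\ge 0$ and $k\ge 0$ be integers with $k+1<d_l$, let $N\ge k$, let $U\subset\mathbb R^{d_l}\times\mathbb R^{d_r}$ be open, and let $\rho:U\to\mathbb R$ and $\varphi:U\to\mathbb R^N$ be smooth; write $\varphi^{(k)}=(\varphi_1,\dots,\varphi_k)$. Notation. $|v_1\cdots v_d|$ is the absolute value of the determinant of the matrix with rows $v_1,\dots,v_d\in\mathbb R^d$. For a tuple $V=(v_1,\dots,v_{k+1})$ of vectors of $\mathbb R^{d_l}$, $T_V:\mathbb R^{d_l}\to\mathbb R^{d_l-k-1}$ is a linear map with $|T_Vz_1\cdots T_Vz_{d_l-k-1}|=|v_1\cdots v_{k+1}\,z_1\cdots z_{d_l-k-1}|$ for all $z_i\in\mathbb R^{d_l}$ (such a map always exists, and the condition (1) below does not depend on its choice). Put $V_{x,y}=(\partial_x\varphi_1(x,y),\dots,\partial_x\varphi_k(x,y),\partial_x\rho(x,y))$. For closed $E\subset U$ and a map $F$ on $U$ with values in a Euclidean space, $|F(E)|_L=\operatorname{ess\,sup}_y|F(E^y)|$ is the left width, where $E^y=\{x:(x,y)\in E\}$, $F(E^y)=\{F(x,y):x\in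 E^y\}$ and $|\cdot|$ is Lebesgue measure (on $\mathbb R^0$ a point has measure $1$). Multiplicity. Let $m=d_l-k$, let $U^*=\{(x,y_1,\dots,y_m):(x,y_j)\in U\text{ for all }j\}$, and let $$\Psi(x,y_1,\dots,y_m)=\bigl(\varphi^{(k)}(x,y_1),\rho(x,y_1),\dots,\rho(x,y_m),y_1,\dots,y_m\bigr).$$ Assume that the nondegenerate multiplicity of $\Psi$ is at most $\nu<\infty$: for every value $c$, at most $\nu$ points of $U^*$ satisfy $\Psi=c$ and have nonvanishing Jacobian determinant of $\Psi$. Theorem. There is a finite (so-called topological) constant $C$, depending only on $d_l$, $k$ and $\nu$, with the following property. Let $E\subset U$ be closed, let $w$ be a measurable real weight, let $s>0$, $\alpha\ge 0$ and $0\le K_E<\infty$, and suppose that $$\sup_{Q\in GL(d_l-k-1,\mathbb R)}\ \sup_{(x,y_1)\in U}\ |\det Q|^{\frac{s}{d_l-k-1}}\int\frac{|w(x,y)|\,\chi_E(x,y)}{1+|Q\,T_{V_{x,y_1}}\partial_x\rho(x,y)|^{\alpha}}\,dy\ \le K_E. \tag{1}$$ Let $\overline s=\frac{d_l-k}{d_l-k-1}s$,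 $\frac1{p'}=1-\frac1{d_l-k}\frac{\overline s}{\overline s+1}$ and $K'_E=\bigl(|\varphi^{(k)}(E)|_L\bigr)^{\overline s/(d_l-k)}K_E$. Then for all measurable $f:\mathbb R^{d_l}\to\mathbb C$ and $g:\mathbb R^{d_r}\to\mathbb C$, $$\int\chi_E(x,y)\,|w(x,y)|^{\frac1{\overline s+1}}|f(x)g(y)|\,dx\,dy\ \le\ C\,{K'_E}^{\frac1{\overline s+1}}\,|\rho(E)|_L^{\frac{\overline s}{\overline s+1}}\,\|f\|_{p'}\,\|g\|_{\frac{\overline s+1}{\overline s}}$$ (both sides in $[0,\infty]$, with $0\cdot\infty=0$). -/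

import Mathlib

open MeasureTheory
open scoped ENNReal NNReal ContDiff

/-- `ℝ^n` with its Euclidean norm and Lebesgue measure. -/
abbrev Eu (n : ℕ) : Type := EuclideanSpace ℝ (Fin n)

/-- `|v_1 ⋯ v_d|`: the absolute value of the determinant of the matrix with rows `v_1, …, v_d`. -/
noncomputable def absDet {d : ℕ} (v : Fin d → Eu d) : ℝ :=
  |(Matrix.of fun i j => v i j).det|

/-- For vectors `v_1, …, v_m` of `ℝ^(m+n)`, `n ≥ 1`, there is a linear map `T : ℝ^(m+n) → ℝ^n` with
`|T z_1 ⋯ T z_n| = |v_1 ⋯ v_m z_1 ⋯ z_n|` for all `z_1, …, z_n`. -/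
theorem exists_transverse {m n : ℕ} (hn : 0 < n) (v : Fin m → Eu (m + n)) :
    ∃ T : Eu (m + n) →ₗ[ℝ] Eu n, ∀ z : Fin n → Eu (m + n),
      absDet (fun i => T (z i)) = absDet (Fin.append v z) := by
  classical
  set e : Module.Basis (Fin (m + n)) ℝ (Eu (m + n)) :=
    (EuclideanSpace.basisFun (Fin (m + n)) ℝ).toBasis with he
  have hdet : ∀ u : Fin (m + n) → Eu (m + n), absDet u = |e.det u| := by
    intro u
    rw [Module.Basis.det_apply, absDet, ← Matrix.det_transpose]
    congr 2
  by_cases hv : LinearIndependent ℝ v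
  · let S := Submodule.span ℝ (Set.range v)
    have hS : Module.finrank ℝ S = m := by
      simpa using finrank_span_eq_card hv
    have hq : Module.finrank ℝ (Eu (m + n) ⧸ S) = n := by
      have h := Submodule.finrank_quotient_add_finrank S
      rw [hS] at h
      simp at h
      omega
    let bS : Module.Basis (Fin m) ℝ S := Module.Basis.span hv
    let bQ : Module.Basis (Fin n) ℝ (Eu (m + n) ⧸ S) := Module.finBasisOfFinrankEq ℝ _ hq
    let B : Module.Basis (Fin (m + n)) ℝ (Eu (m + n)) := (bS.sumQuot bQ).reindex finSumFinEquiv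
    let T0 : Eu (m + n) →ₗ[ℝ] Eu n :=
      (WithLp.linearEquiv 2 ℝ (Fin n → ℝ)).symm.toLinearMap ∘ₗ bQ.equivFun.toLinearMap ∘ₗ S.mkQ
    have hT0 : ∀ z i, T0 z i = bQ.repr (S.mkQ z) i := fun z i => rfl
    have hBdet : ∀ z : Fin n → Eu (m + n),
        |B.det (Fin.append v z)| = absDet (fun i => T0 (z i)) := by
      intro z
      have hM : B.toMatrix (Fin.append v z) =
          (Matrix.fromBlocks (1 : Matrix (Fin m) (Fin m) ℝ)
            (Matrix.of fun i j => (bS.sumQuot bQ).repr (z j) (Sum.inl i)) 0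
            (Matrix.of fun i j => T0 (z j) i)).submatrix finSumFinEquiv.symm
              finSumFinEquiv.symm := by
        have hvB : ∀ i, v i = (bS.sumQuot bQ) (Sum.inl i) := by
          intro i
          rw [Module.Basis.sumQuot_inl]
          exact (congrArg Subtype.val (Module.Basis.span_apply hv i)).symm ▸ rfl
        ext i j
        obtain ⟨i, rfl⟩ := finSumFinEquiv.surjective i
        obtain ⟨j, rfl⟩ := finSumFinEquiv.surjective j
        rcases i with i | i <;> rcases j with j | j <;>
          simp [Module.Basis.toMatrix_apply, B, hvB, Matrix.one_apply, hT0,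
            Finsupp.single_apply, eq_comm, Module.Basis.sumQuot_repr_inr]
        intro h
        have h' := congrArg Fin.val h
        simp at h'
        have := j.isLt
        omega
      rw [Module.Basis.det_apply, hM, Matrix.det_submatrix_equiv_self,
        Matrix.det_fromBlocks_zero₂₁, Matrix.det_one, one_mul, absDet, ← Matrix.det_transpose]
      rfl
    refine ⟨(|e.det B| ^ ((n : ℝ)⁻¹)) • T0, fun z => ?_⟩
    have hsc : absDet (fun i => ((|e.det B| ^ ((n : ℝ)⁻¹)) • T0) (z i)) =
        |e.det B| * absDet (fun i => T0 (z i)) := by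
      have h1 : (Matrix.of fun i j => ((|e.det B| ^ ((n : ℝ)⁻¹)) • T0) (z i) j) =
          (|e.det B| ^ ((n : ℝ)⁻¹)) • Matrix.of fun i j => T0 (z i) j := by
        ext i j; simp
      rw [absDet, h1, Matrix.det_smul, abs_mul, abs_pow,
        abs_of_nonneg (Real.rpow_nonneg (abs_nonneg _) _), Fintype.card_fin,
        Real.rpow_inv_natCast_pow (abs_nonneg _) hn.ne', absDet]
    rw [hsc, hdet, ← hBdet, ← abs_mul]
    congr 1
    rw [Module.Basis.det_apply, Module.Basis.det_apply, Module.Basis.det_apply, ← Matrix.det_mul,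
      Module.Basis.toMatrix_mul_toMatrix]
  · refine ⟨0, fun z => ?_⟩
    have h2 : e.det (Fin.append v z) = 0 := by
      by_contra h
      have h3 : IsUnit (e.det (Fin.append v z)) := isUnit_iff_ne_zero.2 h
      have h4 := (Module.Basis.is_basis_iff_det e).2 h3
      apply hv
      have h5 := h4.1.comp (Fin.castAdd n) (Fin.castAdd_injective m n)
      have h7 : Fin.append v z ∘ Fin.castAdd n = v := by
        ext i : 1
        simp
      rwa [h7] at h5
    have : Nonempty (Fin n) := ⟨⟨0, hn⟩⟩
    rw [hdet, h2, absDet]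
    have h6 : (Matrix.of fun (i : Fin n) (j : Fin n) =>
        ((0 : Eu (m + n) →ₗ[ℝ] Eu n) (z i)) j) = 0 := by ext; simp
    rw [h6, Matrix.det_zero]

/-- The projection `T_V` attached to `V = (v_1, …, v_m)`: a linear map `ℝ^(m+n) → ℝ^n` with
`|T_V z_1 ⋯ T_V z_n| = |v_1 ⋯ v_m z_1 ⋯ z_n|` for all `z_1, …, z_n`. -/
noncomputable def projT {m n : ℕ} (hn : 0 < n) (v : Fin m → Eu (m + n)) :
    Eu (m + n) →ₗ[ℝ] Eu n :=
  Classical.choose (exists_transverse hn v)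

theorem projT_spec {m n : ℕ} (hn : 0 < n) (v : Fin m → Eu (m + n)) (z : Fin n → Eu (m + n)) :
    absDet (fun i => projT hn v (z i)) = absDet (Fin.append v z) :=
  Classical.choose_spec (exists_transverse hn v) z

/-- The gradient `∂_x ρ(x, y)` in the first group of variables. -/
noncomputable def gradX {dl dr : ℕ} (ρ : Eu dl × Eu dr → ℝ) (x : Eu dl) (y : Eu dr) : Eu dl :=
  gradient (fun x' => ρ (x', y)) x

/-- `φ^(k)`: the first `k` components of the map `φ`. -/
noncomputable def truncMap {X : Type*} {k M : ℕ} (hM : k ≤ M) (φ : X → Eu M) : X → Eu k :=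
  fun p => WithLp.toLp 2 fun i => φ p (Fin.castLE hM i)

/-- The tuple `V_{x,y} = (∂_x φ_1(x,y), …, ∂_x φ_k(x,y), ∂_x ρ(x,y))`. -/
noncomputable def vecV {k dl dr : ℕ} (ρ : Eu dl × Eu dr → ℝ) (φ : Eu dl × Eu dr → Eu k)
    (x : Eu dl) (y : Eu dr) : Fin (k + 1) → Eu dl :=
  Fin.snoc (fun i => gradX (fun p => φ p i) x y) (gradX ρ x y)

/-- The left width `|F(E)|_L = ess sup_y |F(E^y)|`, where `E^y = {x | (x, y) ∈ E}`. -/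
noncomputable def leftWidth {dl dr : ℕ} {Z : Type*} [MeasureSpace Z] (F : Eu dl × Eu dr → Z)
    (E : Set (Eu dl × Eu dr)) : ℝ≥0∞ :=
  essSup (fun y => volume ((fun x => F (x, y)) '' {x | (x, y) ∈ E})) volume

/-- The geometric integral condition: for all `(x, y₁) ∈ U` and `Q ∈ GL(n, ℝ)`,
`|det Q|^(s/n) ∫ |w(x,y)| χ_E(x,y) / (1 + |Q T_{V_{x,y₁}} ∂_x ρ(x,y)|^α) dy ≤ K`.
Here `n = d_l - k - 1`. -/
def GeomCondition {k n dr : ℕ} (hn : 0 < n) (U E : Set (Eu (k + 1 + n) × Eu dr))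
    (ρ : Eu (k + 1 + n) × Eu dr → ℝ) (φ : Eu (k + 1 + n) × Eu dr → Eu k)
    (w : Eu (k + 1 + n) × Eu dr → ℝ) (s α : ℝ) (K : ℝ≥0) : Prop :=
  ∀ (x : Eu (k + 1 + n)) (y₁ : Eu dr), (x, y₁) ∈ U → ∀ Q : Matrix.GeneralLinearGroup (Fin n) ℝ,
    ENNReal.ofReal (|(Q : Matrix (Fin n) (Fin n) ℝ).det| ^ (s / n)) *
      ∫⁻ y in {y | (x, y) ∈ E}, ‖w (x, y)‖ₑ /
        ENNReal.ofReal (1 + ‖Matrix.toEuclideanLin (Q : Matrix (Fin n) (Fin n) ℝ)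
          (projT hn (vecV ρ φ x y₁) (gradX ρ x y))‖ ^ α) ≤ K

/-- The nondegenerate multiplicity of `Ψ` on `Ω` is at most `N`: every value `c` is attained at no
more than `N` points of `Ω` at which the differential of `Ψ` is bijective (i.e. at which the
Jacobian determinant does not vanish). -/
def NondegMultiplicityLE {X Y : Type*} [NormedAddCommGroup X] [NormedSpace ℝ X]
    [NormedAddCommGroup Y] [NormedSpace ℝ Y] (Ψ : X → Y) (Ω : Set X) (N : ℕ) : Prop :=
  ∀ c : Y, {z | z ∈ Ω ∧ Ψ z = c ∧ Function.Bijective (fderiv ℝ Ψ z)}.encard ≤ N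

/-- `U^* = {(x, y_1, …, y_m) | (x, y_j) ∈ U for all j}`. -/
def starSet {dl dr : ℕ} (m : ℕ) (U : Set (Eu dl × Eu dr)) : Set (Eu dl × (Fin m → Eu dr)) :=
  {z | ∀ j, (z.1, z.2 j) ∈ U}

/-- The incidence mapping
`(x, y_1, …, y_{n+1}) ↦ (φ(x, y_1), ρ(x, y_1), …, ρ(x, y_{n+1}), y_1, …, y_{n+1})`. -/
def incidenceMap {k dl dr : ℕ} (n : ℕ) (ρ : Eu dl × Eu dr → ℝ) (φ : Eu dl × Eu dr → Eu k) :
    Eu dl × (Fin (n + 1) → Eu dr) → Eu k × (Fin (n + 1) → ℝ) × (Fin (n + 1) → Eu dr) :=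
  fun z => (φ (z.1, z.2 0), fun j => ρ (z.1, z.2 j), z.2)

/-! Put n = d_l - k - 1, q = (s' + 1)/s' and r = (n + 1)q. Since 1/p' = 1 - 1/r, Hölder's inequality
in x reduces the claim to an L^r bound for X(x) = ∫ χ_E |w|^{1/(s'+1)} |g| dy
(`lintegral_adjoint_rpow_le`).

The core is an inequality at fixed x (`lintegral_rpow_le_det`): X^r is at most a constant times
K^{(n+1)/s'} times the integral over (y_1, ..., y_{n+1}) of ∏ |g(y_j)|^q against the determinant of
V_{x,y_1} and ∂_xρ(x,y_2), ..., ∂_xρ(x,y_{n+1}), all (x,y_j) lying in E. To prove it, freeze y_1,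
let u(y) = T_V ∂_xρ(x,y), and choose Q of nearly maximal determinant among matrices whose rows a
satisfy ∫ |g|^q |a·u| ≤ 1. Near-maximality makes Qu spread over all directions, so 1/|det Q| is
controlled by the average of |det(u(y_2), ..., u(y_{n+1}))| (`exists_normalizing_matrix`). The
geometric condition, applied to multiples of Q, bounds the w-mass of the sublevel sets of |Qu|;
Hölder with weight 1 + R, R a multiple of |Qu|, then bounds X.

Now integrate in x first. The determinant is the Jacobian of x ↦ (φ(x,y_1), ρ(x,y_1), ...,
ρ(x,y_{n+1})), whose nondegenerate fibres have at most ν points. By the area formula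
(`lintegral_abs_det_fderiv_le_mul_image`) the x-integral is at most ν times the volume of the image,
and the image lies in a product of sets whose measures are controlled by the left widths. The r-th
root yields the stated exponents and makes the constant independent of s. -/

/-! ### Tonelli on finite powers of a measure space. -/

theorem measurable_finCons {Y : Type*} [MeasurableSpace Y] {n : ℕ} :
    Measurable fun z : Y × (Fin n → Y) => (Fin.cons z.1 z.2 : Fin (n + 1) → Y) := by
  refine measurable_pi_lambda _ fun i => ?_
  refine Fin.cases ?_ (fun i => ?_) i
  · simpa using measurable_fst
  · simp only [Fin.cons_succ]
    fun_prop

theorem lintegral_pi_succ {Y : Type*} [MeasurableSpace Y] (ν : Measure Y) [SigmaFinite ν] {n : ℕ}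
    {F : (Fin (n + 1) → Y) → ℝ≥0∞} (hF : Measurable F) :
    ∫⁻ y, F y ∂(Measure.pi fun _ => ν) =
      ∫⁻ y₀, ∫⁻ y, F (Fin.cons y₀ y) ∂(Measure.pi fun _ => ν) ∂ν := by
  have h := (measurePreserving_piFinSuccAbove (fun _ : Fin (n + 1) => ν) 0).symm
  rw [← h.lintegral_comp_emb (MeasurableEquiv.measurableEmbedding _), lintegral_prod]
  · simp [MeasurableEquiv.piFinSuccAbove, Fin.insertNthEquiv, Fin.insertNth_zero']
  · exact (hF.comp (MeasurableEquiv.measurable _)).aemeasurable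

theorem lintegral_pi_succ' {Y : Type*} [MeasurableSpace Y] (ν : Measure Y) [SigmaFinite ν] {n : ℕ}
    {F : (Fin (n + 1) → Y) → ℝ≥0∞} (hF : Measurable F) :
    ∫⁻ y, F y ∂(Measure.pi fun _ => ν) =
      ∫⁻ y, ∫⁻ y₀, F (Fin.cons y₀ y) ∂ν ∂(Measure.pi fun _ => ν) := by
  rw [lintegral_pi_succ ν hF, lintegral_lintegral_swap]
  exact (hF.comp measurable_finCons).aemeasurable

theorem lintegral_pi_prod {Y : Type*} [MeasurableSpace Y] (ν : Measure Y) [SigmaFinite ν]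
    {h : Y → ℝ≥0∞} (hh : Measurable h) (n : ℕ) :
    ∫⁻ y : Fin n → Y, ∏ i, h (y i) ∂(Measure.pi fun _ => ν) = (∫⁻ y, h y ∂ν) ^ n := by
  induction n with
  | zero => simp
  | succ n ih =>
    rw [lintegral_pi_succ ν (by fun_prop)]
    simp_rw [Fin.prod_univ_succ, Fin.cons_zero, Fin.cons_succ]
    have : Measurable fun y : Fin n → Y => ∏ i, h (y i) := by fun_prop
    simp_rw [lintegral_const_mul _ this, ih]
    rw [lintegral_mul_const _ hh, pow_succ']

/-! ### Averages of determinants and the normalising matrix. -/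

/-- A lower bound for the averages of determinants of vectors distributed in every direction. -/
theorem one_le_lintegral_det {Y : Type*} [MeasurableSpace Y] (ν : Measure Y) [SigmaFinite ν]
    {h : Y → ℝ≥0∞} (hh : Measurable h) (n : ℕ) (u : Y → Fin n → ℝ) (hu : Measurable u)
    (H : ∀ (a : Fin n → ℝ) i, ‖a i‖ₑ ≤ 2 * ∫⁻ y, h y * ‖a ⬝ᵥ u y‖ₑ ∂ν) :
    1 ≤ 2 ^ n * ∫⁻ y : Fin n → Y, (∏ i, h (y i)) * ‖(Matrix.of fun i => u (y i)).det‖ₑ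
      ∂(Measure.pi fun _ => ν) := by
  induction n with
  | zero => simp
  | succ n ih =>
    have hdet : ∀ m, ∀ v : Y → Fin m → ℝ, Measurable v →
        Measurable fun y : Fin m → Y => (Matrix.of fun i => v (y i)).det := by
      intro m v hv
      simp_rw [Matrix.det_apply]
      refine Finset.measurable_sum _ fun σ _ => Measurable.const_smul ?_ _
      refine Finset.measurable_prod _ fun i _ => ?_
      exact (measurable_pi_apply i).comp (hv.comp (measurable_pi_apply _))
    -- The induction discards coordinate 0: the hypothesis for the truncated vectors is `H` tested
    -- on covectors with zero entry there.
    have ih' := ih (fun y i => u y i.succ)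
      (measurable_pi_lambda _ fun i => (measurable_pi_apply _).comp hu) (by
        intro a i
        have := H (Fin.cons 0 a) i.succ
        simpa [dotProduct, Fin.sum_univ_succ] using this)
    refine ih'.trans ?_
    rw [lintegral_pi_succ' ν]
    · rw [pow_succ, mul_assoc]
      gcongr
      rw [← lintegral_const_mul' _ _ (by simp)]
      refine lintegral_mono fun y => ?_
      simp_rw [Fin.prod_univ_succ, Fin.cons_zero, Fin.cons_succ]
      -- The signed cofactors of the first row, so that the determinant is linear in that row. Entry
      -- 0 of this covector is the minor of the truncated vectors, and `H a 0` recovers it at the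
      -- price of a factor 2.
      set a : Fin (n + 1) → ℝ := fun j =>
        (-1) ^ (j : ℕ) * (Matrix.of fun i j' => u (y i) (j.succAbove j')).det with ha
      have h1 : ∀ y₀, (Matrix.of fun i => u ((Fin.cons y₀ y : Fin (n + 1) → Y) i)).det =
          a ⬝ᵥ u y₀ := by
        intro y₀
        rw [Matrix.det_succ_row_zero, dotProduct]
        refine Finset.sum_congr rfl fun j _ => ?_
        simp only [ha, Matrix.of_apply, Fin.cons_zero]
        rw [mul_right_comm]
        rfl
      have h2 := H a 0
      have h3 : a 0 = (Matrix.of fun i j' => u (y i) (Fin.succ j')).det := by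
        simp [ha]
      simp_rw [h1]
      rw [h3] at h2
      calc _ ≤ (∏ i, h (y i)) * (2 * ∫⁻ y, h y * ‖a ⬝ᵥ u y‖ₑ ∂ν) := by gcongr
        _ = 2 * ((∏ i, h (y i)) * ∫⁻ y, h y * ‖a ⬝ᵥ u y‖ₑ ∂ν) := by ring
        _ = _ := by
          rw [← lintegral_const_mul]
          · simp_rw [mul_left_comm, mul_assoc]
          · refine hh.mul (Measurable.enorm ?_)
            simp only [dotProduct]
            fun_prop
    · exact Measurable.mul (by fun_prop) (hdet _ u hu).enorm

/-- A matrix normalising a vector-valued density, whose determinant is controlled by the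
averages of determinants. -/
theorem exists_normalizing_matrix {Y : Type*} [MeasurableSpace Y] (ν : Measure Y) [SigmaFinite ν]
    {h : Y → ℝ≥0∞} (hh : Measurable h) (n : ℕ) (u : Y → Fin n → ℝ) (hu : Measurable u)
    (hfin : ∀ i, ∫⁻ y, h y * ‖u y i‖ₑ ∂ν < ⊤) {ε : ℝ} (hε : 0 < ε) :
    ∃ Q : Matrix (Fin n) (Fin n) ℝ, Q.det ≠ 0 ∧ (∀ i, ∫⁻ y, h y * ‖Q i ⬝ᵥ u y‖ₑ ∂ν ≤ 1) ∧
      ENNReal.ofReal (|Q.det|⁻¹) ≤ 2 ^ n * ∫⁻ y : Fin n → Y,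
        (∏ i, h (y i)) * ‖(Matrix.of fun i => u (y i)).det‖ₑ ∂(Measure.pi fun _ => ν)
          + ENNReal.ofReal ε := by
  classical
  set Nm : (Fin n → ℝ) → ℝ≥0∞ := fun a => ∫⁻ y, h y * ‖a ⬝ᵥ u y‖ₑ ∂ν with hNm
  have hmeas : ∀ a : Fin n → ℝ, Measurable fun y => h y * ‖a ⬝ᵥ u y‖ₑ := by
    intro a
    refine hh.mul (Measurable.enorm ?_)
    simp only [dotProduct]
    fun_prop
  have hsmul : ∀ (c : ℝ) a, Nm (c • a) = ‖c‖ₑ * Nm a := by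
    intro c a
    simp only [hNm]
    rw [← lintegral_const_mul _ (hmeas a)]
    simp_rw [smul_dotProduct, smul_eq_mul, enorm_mul, mul_left_comm]
  have hbasis : ∀ i, Nm (Pi.single i 1) < ⊤ := by
    intro i
    simpa [hNm] using hfin i
  have hNfin : ∀ a, Nm a < ⊤ := by
    intro a
    have h1 : Nm a ≤ ∑ i, ‖a i‖ₑ * Nm (Pi.single i 1) := by
      simp_rw [← hsmul]
      simp only [hNm]
      rw [← lintegral_finsetSum _ fun i _ => hmeas _]
      refine lintegral_mono fun y => ?_
      rw [← Finset.mul_sum]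
      gcongr
      have : a ⬝ᵥ u y = ∑ i, (a i • Pi.single i (1 : ℝ)) ⬝ᵥ u y := by
        simp only [smul_dotProduct, single_dotProduct, one_mul, smul_eq_mul]
        rfl
      rw [this]
      exact enorm_sum_le _ _
    exact h1.trans_lt (ENNReal.sum_lt_top.2 fun i _ => ENNReal.mul_lt_top (by simp) (hbasis i))
  let S : Set ℝ := {t | ∃ Q : Matrix (Fin n) (Fin n) ℝ, (∀ i, Nm (Q i) ≤ 1) ∧ |Q.det| = t}
  have hpos : ∃ t ∈ S, 0 < t := by
    obtain ⟨c, hc0, hc⟩ : ∃ c : ℝ, 0 < c ∧ ∀ i, Nm (c • Pi.single i 1) ≤ 1 := by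
      set t : ℝ≥0∞ := ∑ i, Nm (Pi.single i 1) with ht
      have htf : t < ⊤ := ENNReal.sum_lt_top.2 fun i _ => hbasis i
      refine ⟨(t.toReal + 1)⁻¹, by positivity, fun i => ?_⟩
      rw [hsmul]
      have h1 : Nm (Pi.single i 1) ≤ ENNReal.ofReal (t.toReal + 1) := by
        refine (Finset.single_le_sum (f := fun i => Nm (Pi.single i 1)) (fun _ _ => by simp)
          (Finset.mem_univ i)).trans ?_
        rw [← ht, ENNReal.le_ofReal_iff_toReal_le htf.ne (by positivity)]
        linarith
      rw [Real.enorm_eq_ofReal (by positivity)]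
      refine (mul_le_mul_right h1 _).trans ?_
      rw [← ENNReal.ofReal_mul (by positivity), inv_mul_cancel₀ (by positivity)]
      simp
    refine ⟨|(c • (1 : Matrix (Fin n) (Fin n) ℝ)).det|, ⟨c • 1, fun i => ?_, rfl⟩, ?_⟩
    · convert hc i using 2
      ext j
      simp [Matrix.one_apply, Pi.single_apply, eq_comm]
    · simp [hc0.ne']
  -- The determinants may be unbounded, as when the vectors essentially lie in a hyperplane; the
  -- error `ε` in the statement covers that case.
  by_cases hb : BddAbove S
  · set D := sSup S with hD
    obtain ⟨t₀, ht₀, ht₀'⟩ := hpos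
    have hDpos : 0 < D := ht₀'.trans_le (le_csSup hb ht₀)
    obtain ⟨t, ⟨Q, hQ, rfl⟩, hlt⟩ := exists_lt_of_lt_csSup ⟨t₀, ht₀⟩ (half_lt_self hDpos)
    have hQdet : Q.det ≠ 0 := by
      intro h0
      rw [h0, abs_zero] at hlt
      linarith
    refine ⟨Q, hQdet, hQ, ?_⟩
    have key : ∀ (a : Fin n → ℝ) i, Nm (Matrix.vecMul a Q) ≤ 1 → |a i| ≤ 2 := by
      intro a i ha
      -- Replacing row i of Q by aQ multiplies the determinant by a_i and keeps the rows admissible.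
      -- As |det Q| exceeds half the supremum, |a_i| ≤ 2.
      have h1 : |a i| * |Q.det| ∈ S := by
        refine ⟨Q.updateRow i (Matrix.vecMul a Q), fun j => ?_, ?_⟩
        · by_cases hj : j = i
          · subst hj; simpa using ha
          · simpa [Matrix.updateRow_ne hj] using hQ j
        · rw [← abs_mul]
          congr 1
          have : Matrix.vecMul a Q = ∑ k, a k • Q k := by
            ext l; simp [Matrix.vecMul, dotProduct]
          rw [this, Matrix.det_updateRow_sum, smul_eq_mul]
      have h2 := le_csSup hb h1
      have : |a i| * |Q.det| ≤ 2 * |Q.det| := by linarith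
      exact le_of_mul_le_mul_right this (abs_pos.2 hQdet)
    have key2 : ∀ (a : Fin n → ℝ) i, ‖a i‖ₑ ≤ 2 * Nm (Matrix.vecMul a Q) := by
      intro a i
      set N0 := Nm (Matrix.vecMul a Q) with hN0
      have hf : N0 < ⊤ := hNfin _
      -- Homogeneity of `Nm`; scaling by a strictly larger c avoids dividing by `N0`, which is not
      -- yet known to be nonzero.
      have hle : ∀ c : ℝ, 0 < c → N0.toReal < c → |a i| ≤ 2 * c := by
        intro c hc hcN
        have h1 := key (c⁻¹ • a) i (by
          rw [Matrix.smul_vecMul, hsmul, ← hN0, Real.enorm_eq_ofReal (by positivity),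
            ← ENNReal.ofReal_toReal hf.ne, ← ENNReal.ofReal_mul (by positivity)]
          rw [ENNReal.ofReal_le_one]
          rw [inv_mul_le_iff₀ hc]
          linarith)
        rw [Pi.smul_apply, smul_eq_mul, abs_mul, abs_of_pos (inv_pos.2 hc),
          inv_mul_le_iff₀ hc] at h1
        linarith
      have h3 : |a i| ≤ 2 * N0.toReal := by
        refine le_of_forall_pos_le_add fun δ hδ => ?_
        have := hle (N0.toReal + δ / 2) (by positivity) (by linarith)
        linarith
      rw [← ENNReal.ofReal_toReal hf.ne, Real.enorm_eq_ofReal_abs,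
        ← ENNReal.ofReal_ofNat, ← ENNReal.ofReal_mul (by positivity)]
      exact ENNReal.ofReal_le_ofReal h3
    have hu' : Measurable fun y => Q.mulVec (u y) := by
      refine measurable_pi_lambda _ fun i => ?_
      simp only [Matrix.mulVec, dotProduct]
      fun_prop
    have h4 := one_le_lintegral_det ν hh n (fun y => Q.mulVec (u y)) hu' (by
      intro a i
      simp_rw [Matrix.dotProduct_mulVec]
      exact key2 a i)
    have h5 : ∀ y : Fin n → Y, (Matrix.of fun i => Q.mulVec (u (y i))).det =
        Q.det * (Matrix.of fun i => u (y i)).det := by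
      intro y
      rw [← Matrix.det_transpose Q, mul_comm, ← Matrix.det_mul]
      congr 1
      ext i j
      simp [Matrix.mul_apply, Matrix.mulVec, dotProduct, mul_comm]
    simp_rw [h5, enorm_mul, mul_left_comm _ ‖Q.det‖ₑ] at h4
    rw [lintegral_const_mul' _ _ (by simp)] at h4
    refine le_trans ?_ (le_add_right le_rfl)
    set I := ∫⁻ y : Fin n → Y, (∏ i, h (y i)) * ‖(Matrix.of fun i => u (y i)).det‖ₑ
      ∂(Measure.pi fun _ => ν)
    calc ENNReal.ofReal (|Q.det|⁻¹)
        ≤ ENNReal.ofReal (|Q.det|⁻¹) * (2 ^ n * (‖Q.det‖ₑ * I)) := le_mul_of_one_le_right' h4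
      _ = (ENNReal.ofReal (|Q.det|⁻¹) * ‖Q.det‖ₑ) * (2 ^ n * I) := by ring
      _ = 2 ^ n * I := by
        rw [Real.enorm_eq_ofReal_abs, ← ENNReal.ofReal_mul (by positivity),
          inv_mul_cancel₀ (abs_ne_zero.2 hQdet)]
        simp
  · rw [not_bddAbove_iff] at hb
    obtain ⟨t, ⟨Q, hQ, rfl⟩, hlt⟩ := hb ε⁻¹
    have h0 : 0 < |Q.det| := (inv_pos.2 hε).trans hlt
    refine ⟨Q, abs_pos.1 h0, hQ, le_trans ?_ (le_add_left le_rfl)⟩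
    exact ENNReal.ofReal_le_ofReal (inv_le_of_inv_le₀ hε hlt.le)

/-! ### The determinantal inequality at fixed x. -/

/-- Split into the shells b^j ≤ R < b^{j+1}: each contributes at most D b^s b^{-js/n}, because the
decay exponent exceeds the growth exponent s by s/n. The region R ≤ 1 contributes at most D. -/
theorem lintegral_rpow_neg_le_of_tail {Y : Type*} [MeasurableSpace Y] (ν : Measure Y)
    {w : Y → ℝ≥0∞} (hw : Measurable w) {R : Y → ℝ} (hR : Measurable R) (hR0 : ∀ y, 0 ≤ R y)
    {s : ℝ} (hs : 0 < s) {n : ℕ} (hn : 0 < n) {D : ℝ≥0∞}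
    (H : ∀ t : ℝ, 0 < t → ∫⁻ y in {y | R y ≤ t}, w y ∂ν ≤ D * ENNReal.ofReal (t ^ s)) :
    ∫⁻ y, w y * ENNReal.ofReal ((1 + R y) ^ (-(s + s / n))) ∂ν ≤
      ENNReal.ofReal (3 * 2 ^ (s + n)) * D := by
  have hn' : (0 : ℝ) < n := by exact_mod_cast hn
  set s' := s + s / n with hs'
  have hs'0 : 0 < s' := by positivity
  -- This ratio depends on s so that b^{s/n} ≥ 2, bounding the geometric series by 2 for every s.
  -- The cost b^s = 2^{s+n} becomes harmless after the root of order s' + 1.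
  set b : ℝ := 2 ^ (1 + n / s) with hb
  have hb1 : 1 < b := Real.one_lt_rpow (by norm_num) (by positivity)
  have hb0 : 0 < b := by positivity
  have hset : ∀ t, MeasurableSet {y | R y ≤ t} := fun t => measurableSet_le hR measurable_const
  have hpt : ∀ y, w y * ENNReal.ofReal ((1 + R y) ^ (-s')) ≤
      {y | R y ≤ 1}.indicator w y + ∑' j : ℕ, ENNReal.ofReal ((b ^ j) ^ (-s')) *
        {y | R y ≤ b ^ (j + 1)}.indicator w y := by
    intro y
    rcases le_or_gt (R y) 1 with h | h
    · refine le_add_right ?_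
      rw [Set.indicator_of_mem (by exact h)]
      refine mul_le_of_le_one_right' ?_
      rw [ENNReal.ofReal_le_one]
      exact Real.rpow_le_one_of_one_le_of_nonpos (by linarith [hR0 y]) (by linarith)
    · obtain ⟨j, hj1, hj2⟩ := exists_nat_pow_near h.le hb1
      refine le_add_left (le_trans ?_ (ENNReal.le_tsum j))
      rw [Set.indicator_of_mem (by exact hj2.le), mul_comm]
      gcongr ?_ * _
      refine ENNReal.ofReal_le_ofReal ?_
      exact Real.rpow_le_rpow_of_nonpos (by positivity) (by linarith) (by linarith)
  refine (lintegral_mono hpt).trans ?_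
  rw [lintegral_add_left (hw.indicator (hset 1)), lintegral_indicator (hset 1),
    lintegral_tsum fun j => ((hw.indicator (hset _)).const_mul _).aemeasurable]
  simp_rw [lintegral_const_mul' _ _ ENNReal.ofReal_ne_top]
  have hbs : b ^ s = 2 ^ (s + n) := by
    rw [hb, ← Real.rpow_mul (by norm_num)]
    congr 1
    field_simp
  have hterm : ∀ j : ℕ, ENNReal.ofReal ((b ^ j) ^ (-s')) *
      ∫⁻ y, {y | R y ≤ b ^ (j + 1)}.indicator w y ∂ν ≤
        D * (ENNReal.ofReal (2 ^ (s + n)) * 2⁻¹ ^ j) := by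
    intro j
    rw [lintegral_indicator (hset _)]
    refine (mul_le_mul_right (H _ (by positivity)) _).trans ?_
    rw [mul_left_comm]
    gcongr D * ?_
    rw [← ENNReal.ofReal_mul (by positivity)]
    have e1 : (b ^ j) ^ (-s') * (b ^ (j + 1)) ^ s = 2 ^ (s + n) * ((b ^ (s / n))⁻¹) ^ j := by
      rw [pow_succ, Real.mul_rpow (by positivity) (by positivity), hbs, ← mul_assoc,
        ← Real.rpow_add (by positivity), mul_comm, ← Real.rpow_neg hb0.le, ← Real.rpow_natCast,
        ← Real.rpow_natCast, ← Real.rpow_mul hb0.le, ← Real.rpow_mul hb0.le]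
      congr 2
      rw [hs']
      ring
    have e2 : (b ^ (s / n))⁻¹ ≤ 2⁻¹ := by
      refine inv_anti₀ (by norm_num) ?_
      rw [hb, ← Real.rpow_mul (by norm_num)]
      nth_rw 1 [← Real.rpow_one 2]
      refine Real.rpow_le_rpow_of_exponent_le (by norm_num) ?_
      have : (1 + n / s) * (s / n) = s / n + 1 := by field_simp
      rw [this]
      linarith [div_pos hs hn']
    rw [e1]
    calc ENNReal.ofReal (2 ^ (s + n) * ((b ^ (s / n))⁻¹) ^ j)
        ≤ ENNReal.ofReal (2 ^ (s + n) * 2⁻¹ ^ j) := by gcongr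
      _ = _ := by
        rw [ENNReal.ofReal_mul (by positivity), ENNReal.ofReal_pow (by positivity),
          ENNReal.ofReal_inv_of_pos (by norm_num), ENNReal.ofReal_ofNat]
  have h1 := H 1 one_pos
  rw [Real.one_rpow, ENNReal.ofReal_one, mul_one] at h1
  refine (add_le_add h1 (ENNReal.tsum_le_tsum hterm)).trans ?_
  rw [ENNReal.tsum_mul_left, ENNReal.tsum_mul_left, ENNReal.tsum_geometric]
  have h2 : (1 - 2⁻¹ : ℝ≥0∞)⁻¹ = ENNReal.ofReal 2 := by
    rw [ENNReal.one_sub_inv_two, inv_inv, ENNReal.ofReal_ofNat]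
  rw [h2, ← ENNReal.ofReal_mul (by positivity)]
  nth_rw 1 [← mul_one D]
  rw [← mul_add, mul_comm, ← ENNReal.ofReal_one, ← ENNReal.ofReal_add (by norm_num) (by positivity)]
  gcongr
  have : (1 : ℝ) ≤ 2 ^ (s + n) := Real.one_le_rpow (by norm_num) (by positivity)
  linarith

theorem norm_le_sum_abs {n : ℕ} (v : Eu n) : ‖v‖ ≤ ∑ i, |v i| := by
  have h := (EuclideanSpace.basisFun (Fin n) ℝ).sum_repr v
  calc ‖v‖ = ‖∑ i, (EuclideanSpace.basisFun (Fin n) ℝ).repr v i •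
        (EuclideanSpace.basisFun (Fin n) ℝ) i‖ := by rw [h]
    _ ≤ _ := by
      refine (norm_sum_le _ _).trans (le_of_eq ?_)
      simp [norm_smul]

/-- Hölder's inequality with the weight `1 + R`. -/
theorem lintegral_rpow_mul_le {Y : Type*} [MeasurableSpace Y] (ν : Measure Y)
    {w g : Y → ℝ≥0∞} (hw : Measurable w) (hg : Measurable g) {R : Y → ℝ} (hR : Measurable R)
    (hR0 : ∀ y, 0 ≤ R y) {s' : ℝ} (hs' : 0 < s') :
    ∫⁻ y, w y ^ (1 / (s' + 1)) * g y ∂ν ≤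
      (∫⁻ y, w y * ENNReal.ofReal ((1 + R y) ^ (-s')) ∂ν) ^ (1 / (s' + 1)) *
      (∫⁻ y, g y ^ ((s' + 1) / s') * ENNReal.ofReal (1 + R y) ∂ν) ^ (s' / (s' + 1)) := by
  have hpq : (s' + 1).HolderConjugate ((s' + 1) / s') := by
    rw [Real.holderConjugate_iff]
    refine ⟨by linarith, ?_⟩
    field_simp
    ring
  have h := ENNReal.lintegral_mul_le_Lp_mul_Lq ν hpq
    (f := fun y => (w y * ENNReal.ofReal ((1 + R y) ^ (-s'))) ^ (1 / (s' + 1)))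
    (g := fun y => (g y ^ ((s' + 1) / s') * ENNReal.ofReal (1 + R y)) ^ (s' / (s' + 1)))
    (by fun_prop) (by fun_prop)
  simp only [← ENNReal.rpow_mul] at h
  have e1 : 1 / (s' + 1) * (s' + 1) = 1 := by field_simp
  have e2 : s' / (s' + 1) * ((s' + 1) / s') = 1 := by field_simp
  have e3 : 1 / ((s' + 1) / s') = s' / (s' + 1) := by field_simp
  simp only [e1, e2, e3, ENNReal.rpow_one] at h
  refine le_trans (le_of_eq ?_) h
  refine lintegral_congr fun y => ?_
  have hp : 0 < 1 + R y := by linarith [hR0 y]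
  rw [Pi.mul_apply, ENNReal.mul_rpow_of_nonneg _ _ (by positivity),
    ENNReal.mul_rpow_of_nonneg _ _ (by positivity), ← ENNReal.rpow_mul, ENNReal.ofReal_rpow_of_pos hp,
    ENNReal.ofReal_rpow_of_pos (by positivity), ← Real.rpow_mul hp.le]
  have e4 : (s' + 1) / s' * (s' / (s' + 1)) = 1 := by field_simp
  rw [e4, ENNReal.rpow_one]
  have e5 : ENNReal.ofReal ((1 + R y) ^ (-s' * (1 / (s' + 1)))) *
      ENNReal.ofReal ((1 + R y) ^ (s' / (s' + 1))) = 1 := by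
    rw [← ENNReal.ofReal_mul (by positivity), ← Real.rpow_add hp]
    have : -s' * (1 / (s' + 1)) + s' / (s' + 1) = 0 := by ring
    rw [this, Real.rpow_zero, ENNReal.ofReal_one]
  calc _ = w y ^ (1 / (s' + 1)) * g y * 1 := by rw [mul_one]
    _ = _ := by rw [← e5]; ring

/-- The constant of the pointwise inequality. -/
noncomputable def pointwiseConst (n : ℕ) (s s' : ℝ) : ℝ :=
  (3 * 2 ^ (s + n)) ^ ((n + 1) / s') * (n + 1) ^ (n + 1 : ℝ) * 2 ^ n

/-- The case of a single family u. Weighted Hölder bounds X by two integrals; with Q normalised,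
their product raised to the power (n + 1)q is a constant times K^{(n+1)/s'} B/|det Q|, and 1/|det Q|
is at most the determinant average up to ε. -/
theorem lintegral_rpow_le_det_aux {Y : Type*} [MeasurableSpace Y] (ν : Measure Y) [SigmaFinite ν]
    {w g : Y → ℝ≥0∞} (hw : Measurable w) (hg : Measurable g) {n : ℕ} (hn : 0 < n)
    {u : Y → Eu n} (hu : Measurable u) {s s' : ℝ} (hs : 0 < s) (hs' : s' = s + s / n) {K : ℝ≥0}
    (H : ∀ Q : Matrix.GeneralLinearGroup (Fin n) ℝ,
      ENNReal.ofReal (|(Q : Matrix (Fin n) (Fin n) ℝ).det| ^ (s / n)) *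
        ∫⁻ y in {y | ‖Matrix.toEuclideanLin (Q : Matrix (Fin n) (Fin n) ℝ) (u y)‖ ≤ 1}, w y ∂ν ≤ K)
    (hB : ∫⁻ y, g y ^ ((s' + 1) / s') ∂ν ≠ ⊤)
    (hfin : ∀ i, ∫⁻ y, g y ^ ((s' + 1) / s') * ‖u y i‖ₑ ∂ν < ⊤) :
    (∫⁻ y, w y ^ (1 / (s' + 1)) * g y ∂ν) ^ ((n + 1) * ((s' + 1) / s')) ≤
      ENNReal.ofReal (pointwiseConst n s s') * K ^ ((n + 1) / s') *
        ((∫⁻ y, g y ^ ((s' + 1) / s') ∂ν) *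
          ∫⁻ y : Fin n → Y, (∏ i, g (y i) ^ ((s' + 1) / s')) *
            ENNReal.ofReal (absDet fun i => u (y i)) ∂(Measure.pi fun _ => ν)) := by
  have hn' : (0 : ℝ) < n := by exact_mod_cast hn
  have hs'0 : 0 < s' := by rw [hs']; positivity
  set q := (s' + 1) / s' with hq
  have hq0 : 0 < q := by positivity
  set B := ∫⁻ y, g y ^ q ∂ν with hBdef
  set I := ∫⁻ y : Fin n → Y, (∏ i, g (y i) ^ q) *
    ENNReal.ofReal (absDet fun i => u (y i)) ∂(Measure.pi fun _ => ν) with hI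
  set X := ∫⁻ y, w y ^ (1 / (s' + 1)) * g y ∂ν with hX
  have hexp : 0 < (n + 1) * q := by positivity
  by_cases hB0 : B = 0
  · rw [hBdef, lintegral_eq_zero_iff (by fun_prop)] at hB0
    have : X = 0 := by
      rw [hX, lintegral_eq_zero_iff (by fun_prop)]
      filter_upwards [hB0] with y hy
      simp only [Pi.zero_apply, ENNReal.rpow_eq_zero_iff_of_pos hq0] at hy
      simp [hy]
    rw [this, ENNReal.zero_rpow_of_pos hexp]
    simp
  set B₀ := B.toReal with hB₀
  have hB₀pos : 0 < B₀ := ENNReal.toReal_pos hB0 hB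
  have hBB : B = ENNReal.ofReal B₀ := (ENNReal.ofReal_toReal hB).symm
  have hu' : Measurable fun y => (u y : Fin n → ℝ) :=
    measurable_pi_lambda _ fun i => by fun_prop
  set c : ℝ := (3 * 2 ^ (s + n)) ^ ((n + 1) / s') * (n + 1) ^ (n + 1 : ℝ) with hc
  have hc0 : 0 < c := by positivity
  have key : ∀ ε : ℝ, 0 < ε → X ^ ((n + 1) * q) ≤
      ENNReal.ofReal c * K ^ ((n + 1) / s') * (B * (2 ^ n * I + ENNReal.ofReal ε)) := by
    intro ε hε
    obtain ⟨Q, hQ0, hQ1, hQ2⟩ := exists_normalizing_matrix ν (h := fun y => g y ^ q) (by fun_prop)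
      n (fun y => (u y : Fin n → ℝ)) hu' hfin hε
    have hI' : ∫⁻ y : Fin n → Y, (∏ i, g (y i) ^ q) *
        ‖(Matrix.of fun i => (u (y i) : Fin n → ℝ)).det‖ₑ ∂(Measure.pi fun _ => ν) = I := by
      simp_rw [hI, Real.enorm_eq_ofReal_abs]
      rfl
    rw [hI'] at hQ2
    -- The factor `B₀` balances the two terms of the weight: each row of Q has integral at most 1,
    -- so the integral of g^q R is at most n B₀, comparable with that of g^q.
    set R : Y → ℝ := fun y => B₀ * ‖Matrix.toEuclideanLin Q (u y)‖ with hRdef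
    have hQu : Measurable fun y => Matrix.toEuclideanLin Q (u y) :=
      (Matrix.toEuclideanLin Q).toContinuousLinearMap.measurable.comp hu
    have hR : Measurable R := hQu.norm.const_mul _
    have hR0 : ∀ y, 0 ≤ R y := fun y => by positivity
    have hdet0 : 0 < |Q.det| := abs_pos.2 hQ0
    set D : ℝ≥0∞ := K * ENNReal.ofReal (B₀ ^ (-s) * |Q.det| ^ (-(s / n))) with hD
    have htail : ∀ t : ℝ, 0 < t → ∫⁻ y in {y | R y ≤ t}, w y ∂ν ≤ D * ENNReal.ofReal (t ^ s) := by
      intro t ht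
      have hr : 0 < B₀ / t := by positivity
      have hdet : ((B₀ / t) • Q).det ≠ 0 := by
        rw [Matrix.det_smul]
        exact mul_ne_zero (by positivity) hQ0
      -- The set R ≤ t is the unit sublevel set for (B₀/t)Q, whose determinant factor supplies t^s.
      have h1 := H (Matrix.GeneralLinearGroup.mkOfDetNeZero ((B₀ / t) • Q) hdet)
      have h2 : ((Matrix.GeneralLinearGroup.mkOfDetNeZero ((B₀ / t) • Q) hdet :
        Matrix.GeneralLinearGroup (Fin n) ℝ) : Matrix (Fin n) (Fin n) ℝ) = (B₀ / t) • Q := rfl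
      have h3 : {y | ‖Matrix.toEuclideanLin ((B₀ / t) • Q) (u y)‖ ≤ 1} = {y | R y ≤ t} := by
        ext y
        simp only [Set.mem_ofPred_eq, map_smul, LinearMap.smul_apply, norm_smul, hRdef,
          Real.norm_of_nonneg hr.le]
        rw [div_mul_eq_mul_div, div_le_one ht]
      have h4 : |((B₀ / t) • Q).det| ^ (s / n) = (B₀ ^ (-s) * |Q.det| ^ (-(s / n)) * t ^ s)⁻¹ := by
        rw [Matrix.det_smul, Fintype.card_fin, abs_mul, abs_pow, abs_of_pos hr,
          Real.mul_rpow (by positivity) (by positivity), ← Real.rpow_natCast,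
          ← Real.rpow_mul hr.le, mul_div_cancel₀ _ hn'.ne', Real.div_rpow hB₀pos.le ht.le,
          Real.rpow_neg hB₀pos.le, Real.rpow_neg hdet0.le, mul_inv, mul_inv, inv_inv, inv_inv]
        ring
      rw [h2, h3, h4, ENNReal.ofReal_inv_of_pos (by positivity), mul_comm, ← div_eq_mul_inv,
        ENNReal.div_le_iff (by simpa using by positivity) ENNReal.ofReal_ne_top] at h1
      refine h1.trans (le_of_eq ?_)
      rw [hD, ENNReal.ofReal_mul (q := t ^ s) (by positivity), mul_assoc]
    have hT := lintegral_rpow_neg_le_of_tail ν hw hR hR0 hs hn htail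
    rw [← hs'] at hT
    have hG : ∫⁻ y, g y ^ q * ENNReal.ofReal (1 + R y) ∂ν ≤ ENNReal.ofReal ((n + 1) * B₀) := by
      have hpt : ∀ y, g y ^ q * ENNReal.ofReal (1 + R y) ≤ g y ^ q +
          ENNReal.ofReal B₀ * ∑ i, g y ^ q * ‖Q i ⬝ᵥ (u y : Fin n → ℝ)‖ₑ := by
        intro y
        rw [ENNReal.ofReal_add zero_le_one (hR0 y), mul_add, ENNReal.ofReal_one, mul_one,
          ← Finset.mul_sum, mul_left_comm]
        gcongr
        rw [hRdef, ENNReal.ofReal_mul hB₀pos.le]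
        gcongr
        simp_rw [Real.enorm_eq_ofReal_abs]
        rw [← ENNReal.ofReal_sum_of_nonneg fun _ _ => abs_nonneg _]
        exact ENNReal.ofReal_le_ofReal (norm_le_sum_abs _)
      refine (lintegral_mono hpt).trans ?_
      have hm : ∀ i, Measurable fun y => g y ^ q * ‖Q i ⬝ᵥ (u y : Fin n → ℝ)‖ₑ := by
        intro i
        simp only [dotProduct]
        fun_prop
      rw [lintegral_add_left (by fun_prop), lintegral_const_mul' _ _ ENNReal.ofReal_ne_top,
        lintegral_finsetSum _ fun i _ => hm i]
      calc B + ENNReal.ofReal B₀ * ∑ i, ∫⁻ y, g y ^ q * ‖Q i ⬝ᵥ (u y : Fin n → ℝ)‖ₑ ∂ν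
          ≤ B + ENNReal.ofReal B₀ * ∑ i : Fin n, 1 := by
            gcongr with i
            exact hQ1 i
        _ = _ := by
          rw [hBB, ENNReal.ofReal_mul (by positivity), ENNReal.ofReal_add (by positivity) zero_le_one,
            ENNReal.ofReal_natCast, ENNReal.ofReal_one]
          simp only [Finset.sum_const, Finset.card_univ, Fintype.card_fin, nsmul_eq_mul, mul_one]
          ring
    have hX1 : X ≤ (ENNReal.ofReal (3 * 2 ^ (s + n)) * D) ^ (1 / (s' + 1)) *
        ENNReal.ofReal ((n + 1) * B₀) ^ (s' / (s' + 1)) := by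
      refine (lintegral_rpow_mul_le ν hw hg hR hR0 hs'0).trans ?_
      gcongr
    have e1 : 1 / (s' + 1) * ((n + 1) * q) = (n + 1) / s' := by
      rw [hq]; field_simp
    have e2 : s' / (s' + 1) * ((n + 1) * q) = n + 1 := by
      rw [hq]; field_simp
    have e3 : s * ((n + 1) / s') = n := by
      rw [hs']; field_simp
    have e4 : s / n * ((n + 1) / s') = 1 := by
      rw [hs']; field_simp
    calc X ^ ((n + 1) * q) ≤ ((ENNReal.ofReal (3 * 2 ^ (s + n)) * D) ^ (1 / (s' + 1)) *
        ENNReal.ofReal ((n + 1) * B₀) ^ (s' / (s' + 1))) ^ ((n + 1) * q) := by gcongr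
      _ = ENNReal.ofReal (3 * 2 ^ (s + n)) ^ ((n + 1) / s') * D ^ ((n + 1) / s') *
          ENNReal.ofReal ((n + 1) * B₀) ^ (n + 1 : ℝ) := by
        rw [ENNReal.mul_rpow_of_nonneg _ _ hexp.le, ← ENNReal.rpow_mul, ← ENNReal.rpow_mul, e1, e2,
          ENNReal.mul_rpow_of_nonneg _ _ (by positivity)]
      -- Since s(n+1)/s' = n, the power of `D` contributes B₀^{-n}|det Q|^{-1}; against B₀^{n+1}
      -- from the second integral exactly one `B₀` survives.
      _ = K ^ ((n + 1) / s') * ENNReal.ofReal (c * B₀ * |Q.det|⁻¹) := by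
        rw [hD, ENNReal.mul_rpow_of_nonneg _ _ (by positivity),
          ENNReal.ofReal_rpow_of_pos (by positivity), ENNReal.ofReal_rpow_of_pos (by positivity),
          ENNReal.ofReal_rpow_of_pos (by positivity), mul_left_comm, mul_assoc,
          ← ENNReal.ofReal_mul (by positivity), ← ENNReal.ofReal_mul (by positivity)]
        congr 2
        rw [Real.mul_rpow (x := B₀ ^ (-s)) (by positivity) (by positivity),
          ← Real.rpow_mul hB₀pos.le,
          ← Real.rpow_mul hdet0.le, neg_mul, neg_mul, e3, e4, Real.rpow_neg_one,
          Real.mul_rpow (x := (n : ℝ) + 1) (by positivity) hB₀pos.le, Real.rpow_add_one hB₀pos.ne',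
          Real.rpow_neg hB₀pos.le, hc]
        have : B₀ ^ (n : ℝ) ≠ 0 := by positivity
        field_simp
      _ ≤ _ := by
        rw [ENNReal.ofReal_mul (by positivity), ENNReal.ofReal_mul (by positivity), ← hBB]
        calc _ = ENNReal.ofReal c * K ^ ((n + 1) / s') * (B * ENNReal.ofReal |Q.det|⁻¹) := by ring
          _ ≤ _ := by gcongr
  set A := ENNReal.ofReal c * (K : ℝ≥0∞) ^ ((n + 1) / s') * B with hA
  have hAtop : A ≠ ⊤ := by
    refine ENNReal.mul_ne_top (ENNReal.mul_ne_top ENNReal.ofReal_ne_top ?_) hB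
    exact ENNReal.rpow_ne_top_of_nonneg (by positivity) ENNReal.coe_ne_top
  -- Let ε tend to 0, which is allowed because `A` is finite.
  have hfinal : X ^ ((n + 1) * q) ≤ A * (2 ^ n * I) := by
    refine ENNReal.le_of_forall_pos_le_add fun δ hδ _ => ?_
    have h1 := key (δ / (A.toReal + 1)) (by positivity)
    rw [← mul_assoc, ← hA, mul_add] at h1
    refine h1.trans ?_
    gcongr
    rw [← ENNReal.ofReal_toReal hAtop, ← ENNReal.ofReal_mul ENNReal.toReal_nonneg,
      ENNReal.ofReal_le_iff_le_toReal (by simp), ENNReal.toReal_ofReal ENNReal.toReal_nonneg,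
      ENNReal.coe_toReal, mul_div_assoc', div_le_iff₀ (by positivity)]
    nlinarith [hδ, NNReal.coe_pos.2 hδ]
  refine hfinal.trans (le_of_eq ?_)
  have : ENNReal.ofReal (pointwiseConst n s s') = ENNReal.ofReal c * 2 ^ n := by
    rw [pointwiseConst, ← hc, ENNReal.ofReal_mul hc0.le, ENNReal.ofReal_pow (by norm_num),
      ENNReal.ofReal_ofNat]
  rw [hA, this]
  ring

/-- Average the previous bound over y₁ with weight g(y₁)^q: the left side gains the factor ∫ g^q,
which cancels the same factor on the right. Where g(y₁) = 0 nothing is required of `u y₁`. -/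
theorem lintegral_rpow_le_det_of_finite {Y : Type*} [MeasurableSpace Y] (ν : Measure Y)
    [SigmaFinite ν] {w g : Y → ℝ≥0∞} (hw : Measurable w) (hg : Measurable g) {n : ℕ} (hn : 0 < n)
    {u : Y → Y → Eu n} (hu : ∀ y₁, Measurable (u y₁)) {s s' : ℝ} (hs : 0 < s)
    (hs' : s' = s + s / n) {K : ℝ≥0}
    (H : ∀ y₁, g y₁ ≠ 0 → ∀ Q : Matrix.GeneralLinearGroup (Fin n) ℝ,
      ENNReal.ofReal (|(Q : Matrix (Fin n) (Fin n) ℝ).det| ^ (s / n)) *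
        ∫⁻ y in {y | ‖Matrix.toEuclideanLin (Q : Matrix (Fin n) (Fin n) ℝ) (u y₁ y)‖ ≤ 1},
          w y ∂ν ≤ K)
    (hB : ∫⁻ y, g y ^ ((s' + 1) / s') ∂ν ≠ ⊤)
    (hfin : ∀ y₁ i, ∫⁻ y, g y ^ ((s' + 1) / s') * ‖u y₁ y i‖ₑ ∂ν < ⊤) :
    (∫⁻ y, w y ^ (1 / (s' + 1)) * g y ∂ν) ^ ((n + 1) * ((s' + 1) / s')) ≤
      ENNReal.ofReal (pointwiseConst n s s') * K ^ ((n + 1) / s') *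
        ∫⁻ y₁, g y₁ ^ ((s' + 1) / s') * ∫⁻ y : Fin n → Y, (∏ i, g (y i) ^ ((s' + 1) / s')) *
            ENNReal.ofReal (absDet fun i => u y₁ (y i)) ∂(Measure.pi fun _ => ν) ∂ν := by
  have hn' : (0 : ℝ) < n := by exact_mod_cast hn
  have hs'0 : 0 < s' := by rw [hs']; positivity
  set q := (s' + 1) / s' with hq
  have hq0 : 0 < q := by positivity
  set B := ∫⁻ y, g y ^ q ∂ν with hBdef
  set X := ∫⁻ y, w y ^ (1 / (s' + 1)) * g y ∂ν with hX
  have hexp : 0 < (n + 1) * q := by positivity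
  by_cases hB0 : B = 0
  · rw [hBdef, lintegral_eq_zero_iff (by fun_prop)] at hB0
    have : X = 0 := by
      rw [hX, lintegral_eq_zero_iff (by fun_prop)]
      filter_upwards [hB0] with y hy
      simp only [Pi.zero_apply, ENNReal.rpow_eq_zero_iff_of_pos hq0] at hy
      simp [hy]
    rw [this, ENNReal.zero_rpow_of_pos hexp]
    simp
  set c := ENNReal.ofReal (pointwiseConst n s s') * (K : ℝ≥0∞) ^ ((n + 1) / s') with hc
  have hctop : c ≠ ⊤ := ENNReal.mul_ne_top ENNReal.ofReal_ne_top
    (ENNReal.rpow_ne_top_of_nonneg (by positivity) ENNReal.coe_ne_top)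
  set I : Y → ℝ≥0∞ := fun y₁ => ∫⁻ y : Fin n → Y, (∏ i, g (y i) ^ q) *
    ENNReal.ofReal (absDet fun i => u y₁ (y i)) ∂(Measure.pi fun _ => ν) with hI
  have hpt : ∀ y₁, X ^ ((n + 1) * q) * g y₁ ^ q ≤ (c * B) * (g y₁ ^ q * I y₁) := by
    intro y₁
    by_cases h0 : g y₁ = 0
    · simp [h0, ENNReal.zero_rpow_of_pos hq0]
    · have := lintegral_rpow_le_det_aux ν hw hg hn (hu y₁) hs hs' (H y₁ h0) hB (hfin y₁)
      calc _ ≤ (c * (B * I y₁)) * g y₁ ^ q := by gcongr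
        _ = _ := by ring
  have hint := lintegral_mono hpt (μ := ν)
  -- Finiteness of the constant lets it leave the integral without measurability of `I` in y₁, which
  -- is not available for a projection obtained by choice.
  rw [lintegral_const_mul _ (by fun_prop),
    lintegral_const_mul' _ _ (ENNReal.mul_ne_top hctop hB), ← hBdef, mul_comm c B, mul_assoc,
    mul_comm] at hint
  exact (ENNReal.mul_le_mul_iff_right hB0 hB).1 hint

/-- The pointwise determinantal inequality. -/
theorem lintegral_rpow_le_det {Y : Type*} [MeasurableSpace Y] (ν : Measure Y)
    [SigmaFinite ν] {w g : Y → ℝ≥0∞} (hw : Measurable w) (hg : Measurable g)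
    (hgtop : ∀ y, g y ≠ ⊤) {d n : ℕ} (hn : 0 < n) {v : Y → Eu d} (hv : Measurable v)
    (T : Y → Eu d →ₗ[ℝ] Eu n) {s s' : ℝ} (hs : 0 < s)
    (hs' : s' = s + s / n) {K : ℝ≥0}
    (H : ∀ y₁, g y₁ ≠ 0 → ∀ Q : Matrix.GeneralLinearGroup (Fin n) ℝ,
      ENNReal.ofReal (|(Q : Matrix (Fin n) (Fin n) ℝ).det| ^ (s / n)) *
        ∫⁻ y in {y | ‖Matrix.toEuclideanLin (Q : Matrix (Fin n) (Fin n) ℝ) (T y₁ (v y))‖ ≤ 1},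
          w y ∂ν ≤ K) :
    (∫⁻ y, w y ^ (1 / (s' + 1)) * g y ∂ν) ^ ((n + 1) * ((s' + 1) / s')) ≤
      ENNReal.ofReal (pointwiseConst n s s') * K ^ ((n + 1) / s') *
        ∫⁻ y₁, g y₁ ^ ((s' + 1) / s') * ∫⁻ y : Fin n → Y, (∏ i, g (y i) ^ ((s' + 1) / s')) *
            ENNReal.ofReal (absDet fun i => T y₁ (v (y i))) ∂(Measure.pi fun _ => ν) ∂ν := by
  have hn' : (0 : ℝ) < n := by exact_mod_cast hn
  have hs'0 : 0 < s' := by rw [hs']; positivity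
  set q := (s' + 1) / s' with hq
  have hq0 : 0 < q := by positivity
  have hexp : 0 < (n + 1) * q := by positivity
  -- With the power moved to the right, the left side is a plain integral and monotone convergence
  -- over the truncations `S i` applies; on each of them all required integrals are finite.
  rw [← ENNReal.le_rpow_inv_iff hexp]
  let S : ℕ → Set Y := fun i => spanningSets ν i ∩ ({y | g y ≤ i} ∩ {y | ‖v y‖ ≤ i})
  have hS : ∀ i, MeasurableSet (S i) := fun i => (measurableSet_spanningSets ν i).inter
    ((measurableSet_le hg measurable_const).inter (measurableSet_le hv.norm measurable_const))
  have hSmono : Monotone S := by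
    intro i j hij
    refine Set.inter_subset_inter (monotone_spanningSets ν hij) (Set.inter_subset_inter ?_ ?_)
    · intro y hy
      exact le_trans (by exact hy) (by exact_mod_cast hij : (i : ℝ≥0∞) ≤ j)
    · intro y hy
      exact le_trans (by exact hy) (by exact_mod_cast hij : (i : ℝ) ≤ j)
  have hSex : ∀ y, ∃ i, y ∈ S i := by
    intro y
    obtain ⟨i, hi⟩ := ENNReal.exists_nat_gt (hgtop y)
    obtain ⟨j, hj⟩ := exists_nat_ge ‖v y‖
    refine ⟨max (spanningSetsIndex ν y) (max i j), ?_, ?_, ?_⟩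
    · exact monotone_spanningSets ν (le_max_left _ _) (mem_spanningSetsIndex ν y)
    · refine hi.le.trans ?_
      exact_mod_cast (le_max_left i j).trans (le_max_right _ _)
    · refine le_trans hj ?_
      exact_mod_cast (le_max_right i j).trans (le_max_right _ _)
  have hgS : ∀ i y, (S i).indicator g y ≤ g y := fun i y => Set.indicator_le_self _ _ _
  have hsup : ∫⁻ y, w y ^ (1 / (s' + 1)) * g y ∂ν =
      ⨆ i, ∫⁻ y, w y ^ (1 / (s' + 1)) * (S i).indicator g y ∂ν := by
    rw [← lintegral_iSup (fun i => by have := hg.indicator (hS i); fun_prop)]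
    · refine lintegral_congr fun y => le_antisymm ?_ (iSup_le fun i => by gcongr; exact hgS i y)
      obtain ⟨i, hi⟩ := hSex y
      refine le_trans (le_of_eq ?_) (le_iSup _ i)
      rw [Set.indicator_of_mem hi]
    · intro i j hij y
      dsimp only
      gcongr
      exact hSmono hij
  rw [hsup]
  refine iSup_le fun i => ?_
  rw [ENNReal.le_rpow_inv_iff hexp]
  have hpow : ∀ y, (S i).indicator g y ^ q ≤ (S i).indicator (fun _ => (i : ℝ≥0∞) ^ q) y := by
    intro y
    by_cases hy : y ∈ S i
    · rw [Set.indicator_of_mem hy, Set.indicator_of_mem hy]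
      gcongr
      exact hy.2.1
    · rw [Set.indicator_of_notMem hy, Set.indicator_of_notMem hy, ENNReal.zero_rpow_of_pos hq0]
  have hSfin : ν (S i) < ⊤ :=
    (measure_mono Set.inter_subset_left).trans_lt (measure_spanningSets_lt_top ν i)
  have hiq : ((i : ℝ≥0∞) ^ q) ≠ ⊤ :=
    ENNReal.rpow_ne_top_of_nonneg hq0.le (ENNReal.natCast_ne_top i)
  have hTv : ∀ y₁, Measurable fun y => T y₁ (v y) := fun y₁ =>
    (T y₁).toContinuousLinearMap.measurable.comp hv
  have h := lintegral_rpow_le_det_of_finite ν hw (hg.indicator (hS i)) hn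
    (u := fun y₁ y => T y₁ (v y)) hTv hs hs' (K := K)
    (fun y₁ hy₁ Q => H y₁ (fun h0 => hy₁ (le_antisymm ((hgS i y₁).trans h0.le) bot_le)) Q) ?_ ?_
  · refine h.trans ?_
    gcongr
    all_goals exact hgS _ _
  · refine ((lintegral_mono hpow).trans_lt ?_).ne
    rw [lintegral_indicator_const (hS i)]
    exact ENNReal.mul_lt_top hiq.lt_top hSfin
  · intro y₁ j
    set c : ℝ≥0∞ := (i : ℝ≥0∞) ^ q * (‖(T y₁).toContinuousLinearMap‖ₑ * ENNReal.ofReal i) with hc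
    have hcfin : c < ⊤ := ENNReal.mul_lt_top hiq.lt_top
      (ENNReal.mul_lt_top enorm_lt_top ENNReal.ofReal_lt_top)
    have hle : ∀ y, (S i).indicator g y ^ q * ‖T y₁ (v y) j‖ₑ ≤ (S i).indicator (fun _ => c) y := by
      intro y
      by_cases hy : y ∈ S i
      · have h1 := hpow y
        rw [Set.indicator_of_mem hy] at h1 ⊢
        rw [Set.indicator_of_mem hy] at h1 ⊢
        rw [hc]
        gcongr
        have h2 : ‖T y₁ (v y) j‖ₑ ≤ ‖T y₁ (v y)‖ₑ := by
          rw [← ofReal_norm, ← ofReal_norm]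
          exact ENNReal.ofReal_le_ofReal (PiLp.norm_apply_le _ _)
        refine h2.trans (((T y₁).toContinuousLinearMap.le_opENorm (v y)).trans ?_)
        gcongr
        rw [← ofReal_norm]
        exact ENNReal.ofReal_le_ofReal hy.2.2
      · rw [Set.indicator_of_notMem hy, Set.indicator_of_notMem hy, ENNReal.zero_rpow_of_pos hq0,
          zero_mul]
    refine (lintegral_mono hle).trans_lt ?_
    rw [lintegral_indicator_const (hS i)]
    exact ENNReal.mul_lt_top hcfin hSfin

/-! ### Change of variables with multiplicity. -/

/-- The change of variables inequality for maps of finite nondegenerate multiplicity. -/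
theorem lintegral_abs_det_fderiv_le_mul_image {F : Type*} [NormedAddCommGroup F] [NormedSpace ℝ F]
    [FiniteDimensional ℝ F] [MeasurableSpace F] [BorelSpace F] (μ : Measure F)
    [μ.IsAddHaarMeasure] {Ω A : Set F} (hΩ : IsOpen Ω) {f : F → F} (hf : ContDiffOn ℝ 1 f Ω)
    (hA : MeasurableSet A) (hAΩ : A ⊆ Ω) {N : ℕ}
    (hN : ∀ c, {x | x ∈ Ω ∧ f x = c ∧ (fderiv ℝ f x).det ≠ 0}.encard ≤ N) :
    ∫⁻ x in A, ENNReal.ofReal |(fderiv ℝ f x).det| ∂μ ≤ N * μ (f '' A) := by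
  have hmdet : Measurable fun x => (fderiv ℝ f x).det :=
    ContinuousLinearMap.continuous_det.measurable.comp (measurable_fderiv ℝ f)
  set A' := A ∩ {x | (fderiv ℝ f x).det ≠ 0} with hA'
  have hA'm : MeasurableSet A' := hA.inter (hmdet (measurableSet_singleton 0).compl)
  have hint : ∫⁻ x in A, ENNReal.ofReal |(fderiv ℝ f x).det| ∂μ =
      ∫⁻ x in A', ENNReal.ofReal |(fderiv ℝ f x).det| ∂μ := by
    rw [← lintegral_indicator hA, ← lintegral_indicator hA'm]
    refine lintegral_congr fun x => ?_
    by_cases hx : x ∈ A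
    · by_cases hx0 : (fderiv ℝ f x).det = 0
      · rw [Set.indicator_of_mem hx, Set.indicator_of_notMem fun h => h.2 hx0]
        simp [hx0]
      · rw [Set.indicator_of_mem hx, Set.indicator_of_mem (show x ∈ A' from ⟨hx, hx0⟩)]
    · rw [Set.indicator_of_notMem hx, Set.indicator_of_notMem fun h => hx h.1]
  rw [hint]
  rcases A'.eq_empty_or_nonempty with h0 | hne
  · simp [h0]
  -- Off the critical set the inverse function theorem gives local injectivity. A countable
  -- subcover, made disjoint, cuts `A'` into measurable pieces on which the exact area formula
  -- holds.
  have hloc : ∀ x, ∃ V : Set F, x ∈ A' → IsOpen V ∧ x ∈ V ∧ Set.InjOn f V := by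
    intro x
    by_cases hx : x ∈ A'
    · have hc : ContDiffAt ℝ 1 f x := hf.contDiffAt (hΩ.mem_nhds (hAΩ hx.1))
      have hs := hc.hasStrictFDerivAt one_ne_zero
      set e := ContinuousLinearMap.toContinuousLinearEquivOfDetNeZero (fderiv ℝ f x) hx.2 with he
      have hs' : HasStrictFDerivAt f (e : F →L[ℝ] F) x := by
        convert hs using 1
        exact ContinuousLinearMap.coe_toContinuousLinearEquivOfDetNeZero _ hx.2
      refine ⟨(hs'.toOpenPartialHomeomorph f).source, fun _ =>
        ⟨(hs'.toOpenPartialHomeomorph f).open_source, hs'.mem_toOpenPartialHomeomorph_source, ?_⟩⟩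
      exact (hs'.toOpenPartialHomeomorph f).injOn
    · exact ⟨∅, fun h => absurd h hx⟩
  choose V hV using hloc
  obtain ⟨t, htA, htc, htcov⟩ := TopologicalSpace.countable_cover_nhdsWithin (s := A') (f := V)
    fun x hx => mem_nhdsWithin_of_mem_nhds ((hV x hx).1.mem_nhds (hV x hx).2.1)
  have htne : t.Nonempty := by
    rw [Set.nonempty_iff_ne_empty]
    rintro rfl
    obtain ⟨x, hx⟩ := hne
    simpa using htcov hx
  obtain ⟨p, rfl⟩ := htc.exists_eq_range htne
  have hp : ∀ i, p i ∈ A' := fun i => htA ⟨i, rfl⟩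
  set W : ℕ → Set F := fun i => V (p i)
  set P : ℕ → Set F := fun i => A' ∩ disjointed W i with hP
  have hPm : ∀ i, MeasurableSet (P i) := fun i =>
    hA'm.inter (MeasurableSet.disjointed (fun j => (hV _ (hp j)).1.measurableSet) i)
  have hPd : Pairwise (Function.onFun Disjoint P) := fun i j hij =>
    (disjoint_disjointed W hij).mono Set.inter_subset_right Set.inter_subset_right
  have hPU : ⋃ i, P i = A' := by
    rw [hP, ← Set.inter_iUnion, iUnion_disjointed, Set.inter_eq_left]
    intro x hx
    simpa [W] using htcov hx
  have hPA : ∀ i, P i ⊆ A' := fun i => Set.inter_subset_left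
  have hPinj : ∀ i, Set.InjOn f (P i) := fun i =>
    (hV _ (hp i)).2.2.mono (Set.inter_subset_right.trans (disjointed_subset W i))
  have hder : ∀ i, ∀ x ∈ P i, HasFDerivWithinAt f (fderiv ℝ f x) (P i) x := fun i x hx =>
    ((hf.contDiffAt (hΩ.mem_nhds (hAΩ (hPA i hx).1))).differentiableAt
      one_ne_zero).hasFDerivAt.hasFDerivWithinAt
  have him : ∀ i, MeasurableSet (f '' P i) := fun i =>
    measurable_image_of_fderivWithin (hPm i) (hder i) (hPinj i)
  -- Disjoint pieces whose images contain c provide distinct nondegenerate preimages of c, so at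
  -- most N of them do.
  have hcount : ∀ c, ∑' i, (f '' P i).indicator (fun _ => (1 : ℝ≥0∞)) c ≤
      (⋃ i, f '' P i).indicator (fun _ => (N : ℝ≥0∞)) c := by
    intro c
    by_cases hc : c ∈ ⋃ i, f '' P i
    · rw [Set.indicator_of_mem hc, ENNReal.tsum_eq_iSup_sum]
      refine iSup_le fun s => ?_
      classical
      have h1 : ∑ i ∈ s, (f '' P i).indicator (fun _ => (1 : ℝ≥0∞)) c =
          ((s.filter fun i => c ∈ f '' P i).card : ℝ≥0∞) := by
        simp [Set.indicator_apply]
      rw [h1]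
      have h2 : ∀ i ∈ s.filter fun i => c ∈ f '' P i, ∃ x, x ∈ P i ∧ f x = c := fun i hi =>
        (Finset.mem_filter.1 hi).2
      choose! g hg using h2
      have h3 : ((s.filter fun i => c ∈ f '' P i : Finset ℕ) : Set ℕ).encard ≤ N := by
        refine le_trans ?_ (hN c)
        refine Set.encard_le_encard_of_injOn (f := g) ?_ ?_
        · intro i hi
          have := hg i hi
          exact ⟨hAΩ (hPA i this.1).1, this.2, (hPA i this.1).2⟩
        · intro i hi j hj hij
          by_contra hne
          have h4 := (hg i hi).1
          rw [hij] at h4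
          exact Set.disjoint_left.1 (hPd hne) h4 (hg j hj).1
      rw [Set.encard_coe_eq_coe_finsetCard] at h3
      exact_mod_cast h3
    · rw [Set.indicator_of_notMem hc]
      simp only [Set.mem_iUnion, not_exists] at hc
      simp [Set.indicator_of_notMem (hc _)]
  calc ∫⁻ x in A', ENNReal.ofReal |(fderiv ℝ f x).det| ∂μ
      = ∑' i, ∫⁻ x in P i, ENNReal.ofReal |(fderiv ℝ f x).det| ∂μ := by
        rw [← hPU, lintegral_iUnion hPm hPd]
    _ = ∑' i, μ (f '' P i) := by
        refine tsum_congr fun i => ?_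
        exact lintegral_abs_det_fderiv_eq_addHaar_image μ (hPm i) (hder i) (hPinj i)
    _ = ∫⁻ c, ∑' i, (f '' P i).indicator (fun _ => (1 : ℝ≥0∞)) c ∂μ := by
        rw [lintegral_tsum fun i => (measurable_const.indicator (him i)).aemeasurable]
        refine tsum_congr fun i => ?_
        rw [lintegral_indicator_const (him i), one_mul]
    _ ≤ ∫⁻ c, (⋃ i, f '' P i).indicator (fun _ => (N : ℝ≥0∞)) c ∂μ := lintegral_mono hcount
    _ = N * μ (⋃ i, f '' P i) := lintegral_indicator_const (MeasurableSet.iUnion him) _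
    _ ≤ N * μ (f '' A) := by
        gcongr
        refine Set.iUnion_subset fun i => Set.image_mono ?_
        exact (hPA i).trans Set.inter_subset_left

/-! ### Slices of the incidence map at fixed y-variables. -/

theorem abs_det_fderiv_eq_absDet_gradient {d : ℕ} {F : Fin d → Eu d → ℝ} {x : Eu d}
    (hF : ∀ i, DifferentiableAt ℝ (F i) x) :
    |(fderiv ℝ (fun x' => (WithLp.toLp 2 fun i => F i x' : Eu d)) x).det| =
      absDet fun i => gradient (F i) x := by
  set e := (EuclideanSpace.basisFun (Fin d) ℝ).toBasis
  have hd : HasFDerivAt (fun x' => (WithLp.toLp 2 fun i => F i x' : Eu d))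
      ((PiLp.continuousLinearEquiv 2 ℝ (fun _ : Fin d => ℝ)).symm.toContinuousLinearMap ∘L
        ContinuousLinearMap.pi fun i => fderiv ℝ (F i) x) x := by
    have h1 : HasFDerivAt (fun x' i => F i x')
        (ContinuousLinearMap.pi fun i => fderiv ℝ (F i) x) x :=
      hasFDerivAt_pi.2 fun i => (hF i).hasFDerivAt
    exact (PiLp.continuousLinearEquiv 2 ℝ
      (fun _ : Fin d => ℝ)).symm.toContinuousLinearMap.hasFDerivAt.comp x h1
  rw [hd.fderiv, absDet, ContinuousLinearMap.det, ← LinearMap.det_toMatrix e]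
  congr 2
  ext i j
  rw [LinearMap.toMatrix_apply]
  have h2 := (hF i).hasGradientAt.hasFDerivAt.fderiv
  have h3 : fderiv ℝ (F i) x (EuclideanSpace.single j 1) = gradient (F i) x j := by
    rw [h2, InnerProductSpace.toDual_apply_apply, EuclideanSpace.inner_single_right]
    simp
  simp [e, h3]

/-- The coordinates of the incidence map in the fibre over `(y₀, y)`. -/
noncomputable def sliceCoord {k n dl dr : ℕ} (ρ : Eu dl × Eu dr → ℝ) (φ : Eu dl × Eu dr → Eu k)
    (y₀ : Eu dr) (y : Fin n → Eu dr) : Fin (k + 1 + n) → Eu dl → ℝ :=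
  Fin.append (Fin.snoc (fun i x => φ (x, y₀) i) fun x => ρ (x, y₀)) fun j x => ρ (x, y j)

/-- The linear rearrangement of the values of the incidence map. -/
def arrange (k n : ℕ) (Y : Type*) [NormedAddCommGroup Y] [NormedSpace ℝ Y] :
    Eu k × (Fin (n + 1) → ℝ) × Y →ₗ[ℝ] Eu (k + 1 + n) where
  toFun z := WithLp.toLp 2 (Fin.append (Fin.snoc (α := fun _ => ℝ) (fun i => z.1 i) (z.2.1 0))
    fun j => z.2.1 j.succ)
  map_add' z z' := by
    ext i
    refine Fin.addCases (fun i => ?_) (fun i => ?_) i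
    · refine Fin.lastCases ?_ (fun i => ?_) i <;> simp
    · simp
  map_smul' c z := by
    ext i
    refine Fin.addCases (fun i => ?_) (fun i => ?_) i
    · refine Fin.lastCases ?_ (fun i => ?_) i <;> simp
    · simp

theorem arrange_incidenceMap {k n dl dr : ℕ} (ρ : Eu dl × Eu dr → ℝ) (φ : Eu dl × Eu dr → Eu k)
    (y₀ : Eu dr) (y : Fin n → Eu dr) (x : Eu dl) :
    arrange k n _ (incidenceMap n ρ φ (x, Fin.cons y₀ y)) =
      WithLp.toLp 2 fun i => sliceCoord ρ φ y₀ y i x := by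
  ext i
  refine Fin.addCases (fun i => ?_) (fun i => ?_) i
  · refine Fin.lastCases ?_ (fun i => ?_) i <;> simp [arrange, incidenceMap, sliceCoord]
  · simp [arrange, incidenceMap, sliceCoord]

theorem arrange_injective {k n : ℕ} {Y : Type*} [NormedAddCommGroup Y] [NormedSpace ℝ Y]
    {z z' : Eu k × (Fin (n + 1) → ℝ) × Y} (h : arrange k n Y z = arrange k n Y z')
    (h' : z.2.2 = z'.2.2) : z = z' := by
  have hi : ∀ i, (arrange k n Y z) i = (arrange k n Y z') i := fun i => by rw [h]
  refine Prod.ext ?_ (Prod.ext ?_ h')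
  · ext i
    simpa [arrange] using hi (Fin.castAdd n i.castSucc)
  · ext j
    refine Fin.cases ?_ (fun j => ?_) j
    · simpa [arrange] using hi (Fin.castAdd n (Fin.last k))
    · simpa [arrange] using hi (Fin.natAdd (k + 1) j)

theorem sliceCoord_contDiffAt {k n dl dr : ℕ} {U : Set (Eu dl × Eu dr)} (hU : IsOpen U)
    {ρ : Eu dl × Eu dr → ℝ} {φ : Eu dl × Eu dr → Eu k} (hρ : ContDiffOn ℝ ∞ ρ U)
    (hφ : ContDiffOn ℝ ∞ φ U) {y₀ : Eu dr} {y : Fin n → Eu dr} {x : Eu dl} (h₀ : (x, y₀) ∈ U)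
    (h : ∀ j, (x, y j) ∈ U) (i : Fin (k + 1 + n)) :
    ContDiffAt ℝ 1 (sliceCoord ρ φ y₀ y i) x := by
  have hpair : ∀ y : Eu dr, ContDiffAt ℝ 1 (fun x : Eu dl => (x, y)) x := fun y =>
    contDiffAt_id.prodMk contDiffAt_const
  have hr : ∀ y, (x, y) ∈ U → ContDiffAt ℝ 1 (fun x : Eu dl => ρ (x, y)) x := fun y hy =>
    ((hρ.contDiffAt (hU.mem_nhds hy)).of_le (by exact_mod_cast le_top)).comp x (hpair y)
  refine Fin.addCases (fun i => ?_) (fun i => ?_) i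
  · refine Fin.lastCases ?_ (fun i => ?_) i
    · simpa [sliceCoord] using hr y₀ h₀
    · simp only [sliceCoord, Fin.append_left, Fin.snoc_castSucc]
      have h1 := ((hφ.contDiffAt (hU.mem_nhds h₀)).of_le
        (m := 1) (by exact_mod_cast le_top)).comp x (hpair y₀)
      exact contDiffAt_piLp 2 |>.1 h1 i
  · simpa [sliceCoord] using hr _ (h i)

theorem gradient_sliceCoord {k n dl dr : ℕ} (ρ : Eu dl × Eu dr → ℝ) (φ : Eu dl × Eu dr → Eu k)
    (y₀ : Eu dr) (y : Fin n → Eu dr) (x : Eu dl) (i : Fin (k + 1 + n)) :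
    gradient (sliceCoord ρ φ y₀ y i) x =
      Fin.append (vecV ρ φ x y₀) (fun j => gradX ρ x (y j)) i := by
  refine Fin.addCases (fun i => ?_) (fun i => ?_) i
  · refine Fin.lastCases ?_ (fun i => ?_) i <;> simp [sliceCoord, vecV, gradX]
  · simp [sliceCoord, gradX]

theorem incidenceMap_differentiableAt {k n dl dr : ℕ} {U : Set (Eu dl × Eu dr)} (hU : IsOpen U)
    {ρ : Eu dl × Eu dr → ℝ} {φ : Eu dl × Eu dr → Eu k} (hρ : ContDiffOn ℝ ∞ ρ U)
    (hφ : ContDiffOn ℝ ∞ φ U) {z : Eu dl × (Fin (n + 1) → Eu dr)} (hz : ∀ j, (z.1, z.2 j) ∈ U) :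
    DifferentiableAt ℝ (incidenceMap n ρ φ) z := by
  have hpair : ∀ j, DifferentiableAt ℝ
      (fun z : Eu dl × (Fin (n + 1) → Eu dr) => (z.1, z.2 j)) z := fun j => by fun_prop
  have h1 := ((hφ.contDiffAt (hU.mem_nhds (hz 0))).differentiableAt (by simp)).comp z (hpair 0)
  have h2 : ∀ j, DifferentiableAt ℝ
      (fun z : Eu dl × (Fin (n + 1) → Eu dr) => ρ (z.1, z.2 j)) z := fun j =>
    ((hρ.contDiffAt (hU.mem_nhds (hz j))).differentiableAt (by simp)).comp z (hpair j)
  exact h1.prodMk ((differentiableAt_pi.2 h2).prodMk differentiableAt_snd)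

/-- The differential is block triangular, with the identity in the y-variables: a kernel vector has
zero y-part, and the slice Jacobian then kills its x-part. Equality of dimensions gives
surjectivity. -/
theorem bijective_fderiv_incidenceMap {k n dr : ℕ} {U : Set (Eu (k + 1 + n) × Eu dr)}
    (hU : IsOpen U) {ρ : Eu (k + 1 + n) × Eu dr → ℝ} {φ : Eu (k + 1 + n) × Eu dr → Eu k}
    (hρ : ContDiffOn ℝ ∞ ρ U) (hφ : ContDiffOn ℝ ∞ φ U) {y₀ : Eu dr} {y : Fin n → Eu dr}
    {x : Eu (k + 1 + n)} (h₀ : (x, y₀) ∈ U) (h : ∀ j, (x, y j) ∈ U)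
    (hdet : (fderiv ℝ (fun x' => (WithLp.toLp 2 fun i => sliceCoord ρ φ y₀ y i x' :
      Eu (k + 1 + n))) x).det ≠ 0) :
    Function.Bijective (fderiv ℝ (incidenceMap n ρ φ) (x, Fin.cons y₀ y)) := by
  set z : Eu (k + 1 + n) × (Fin (n + 1) → Eu dr) := (x, Fin.cons y₀ y) with hz
  have hd : DifferentiableAt ℝ (incidenceMap n ρ φ) z := incidenceMap_differentiableAt hU hρ hφ
    (Fin.cases (by simpa [hz] using h₀) (fun j => by simpa [hz] using h j))
  set L := fderiv ℝ (incidenceMap n ρ φ) z with hL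
  have hsnd : ∀ p, (L p).2.2 = p.2 := by
    intro p
    have h1 : HasFDerivAt (fun z => (incidenceMap n ρ φ z).2.2)
        (((ContinuousLinearMap.snd ℝ _ _).comp (ContinuousLinearMap.snd ℝ _ _)).comp L) z :=
      hd.hasFDerivAt.snd.snd
    have h2 : HasFDerivAt (fun z : Eu (k + 1 + n) × (Fin (n + 1) → Eu dr) => z.2)
      (ContinuousLinearMap.snd ℝ _ _) z := hasFDerivAt_snd
    have h3 := h1.unique h2
    exact DFunLike.congr_fun h3 p
  have hfst : ∀ ξ, fderiv ℝ (fun x' => (WithLp.toLp 2 fun i => sliceCoord ρ φ y₀ y i x' :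
      Eu (k + 1 + n))) x ξ = arrange k n _ (L (ξ, 0)) := by
    intro ξ
    have h1 : HasFDerivAt (fun x' : Eu (k + 1 + n) => (x', (Fin.cons y₀ y : Fin (n + 1) → Eu dr)))
      (ContinuousLinearMap.inl ℝ _ _) x := hasFDerivAt_prodMk_left x _
    have h2 := hd.hasFDerivAt.comp x h1
    have h3 := (arrange k n (Fin (n + 1) → Eu dr)).toContinuousLinearMap.hasFDerivAt.comp x h2
    have h4 : (fun x' => (WithLp.toLp 2 fun i => sliceCoord ρ φ y₀ y i x' : Eu (k + 1 + n))) =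
        (arrange k n (Fin (n + 1) → Eu dr)).toContinuousLinearMap ∘ incidenceMap n ρ φ ∘
          fun x' => (x', (Fin.cons y₀ y : Fin (n + 1) → Eu dr)) := by
      funext x'
      exact (arrange_incidenceMap ρ φ y₀ y x').symm
    rw [h4, h3.fderiv]
    rfl
  have hinj : Function.Injective L := by
    rw [injective_iff_map_eq_zero]
    intro p hp
    have h2 : p.2 = 0 := by rw [← hsnd p, hp]; rfl
    have hp' : p = (p.1, 0) := Prod.ext rfl h2
    have h3 := hfst p.1
    rw [← hp', hp, map_zero] at h3
    have h4 : p.1 = 0 := by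
      have h5 := (ContinuousLinearMap.toContinuousLinearEquivOfDetNeZero _ hdet).injective
      refine h5 ?_
      rw [map_zero]
      exact h3
    rw [hp', h4]
    rfl
  refine ⟨hinj, ?_⟩
  refine (LinearMap.injective_iff_surjective_of_finrank_eq_finrank (f := L.toLinearMap) ?_).1 hinj
  simp
  ring

/-- Adjoining the fixed y-variables injects a nondegenerate slice fibre into a nondegenerate fibre
of the incidence map. -/
theorem encard_sliceCoord_le {k n dr : ℕ} {U : Set (Eu (k + 1 + n) × Eu dr)}
    (hU : IsOpen U) {ρ : Eu (k + 1 + n) × Eu dr → ℝ} {φ : Eu (k + 1 + n) × Eu dr → Eu k}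
    (hρ : ContDiffOn ℝ ∞ ρ U) (hφ : ContDiffOn ℝ ∞ φ U) {N : ℕ}
    (hN : NondegMultiplicityLE (incidenceMap n ρ φ) (starSet (n + 1) U) N)
    (y₀ : Eu dr) (y : Fin n → Eu dr) (c : Eu (k + 1 + n)) :
    {x | x ∈ {x | (x, y₀) ∈ U ∧ ∀ j, (x, y j) ∈ U} ∧
      WithLp.toLp 2 (fun i => sliceCoord ρ φ y₀ y i x) = c ∧
      (fderiv ℝ (fun x' => (WithLp.toLp 2 fun i => sliceCoord ρ φ y₀ y i x' :
        Eu (k + 1 + n))) x).det ≠ 0}.encard ≤ N := by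
  set S := {x | x ∈ {x | (x, y₀) ∈ U ∧ ∀ j, (x, y j) ∈ U} ∧
      WithLp.toLp 2 (fun i => sliceCoord ρ φ y₀ y i x) = c ∧
      (fderiv ℝ (fun x' => (WithLp.toLp 2 fun i => sliceCoord ρ φ y₀ y i x' :
        Eu (k + 1 + n))) x).det ≠ 0} with hS
  rcases S.eq_empty_or_nonempty with h0 | ⟨x₀, hx₀⟩
  · simp [h0]
  refine le_trans ?_ (hN (incidenceMap n ρ φ (x₀, Fin.cons y₀ y)))
  refine Set.encard_le_encard_of_injOn (f := fun x => (x, Fin.cons y₀ y)) ?_ ?_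
  · rintro x ⟨⟨h1, h2⟩, h3, h4⟩
    refine ⟨Fin.cases (by simpa using h1) (fun j => by simpa using h2 j), ?_,
      bijective_fderiv_incidenceMap hU hρ hφ h1 h2 h4⟩
    refine arrange_injective ?_ rfl
    rw [arrange_incidenceMap, arrange_incidenceMap, h3, hx₀.2.1]
  · intro x _ x' _ hxx
    exact congrArg Prod.fst hxx

theorem volume_coordinates {k n : ℕ} (A : Set (Eu k)) (B₀ : Set ℝ) (B : Fin n → Set ℝ) :
    volume {c : Eu (k + 1 + n) | WithLp.toLp 2 (fun i : Fin k => c (Fin.castAdd n i.castSucc)) ∈ A ∧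
      c (Fin.castAdd n (Fin.last k)) ∈ B₀ ∧ ∀ j, c (Fin.natAdd (k + 1) j) ∈ B j} =
      volume A * volume B₀ * ∏ j, volume (B j) := by
  have h1 := EuclideanSpace.volume_preserving_symm_measurableEquiv_toLp (Fin (k + 1 + n))
  have h2 := (volume_measurePreserving_piCongrLeft (fun _ : Fin (k + 1 + n) => ℝ)
    (finSumFinEquiv (m := k + 1) (n := n))).symm
  have h3 := volume_measurePreserving_sumPiEquivProdPi (fun _ : Fin (k + 1) ⊕ Fin n => ℝ)
  have h4 := volume_preserving_piFinSuccAbove (fun _ : Fin (k + 1) => ℝ) (Fin.last k)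
  have h5 := (EuclideanSpace.volume_preserving_symm_measurableEquiv_toLp (Fin k)).symm
  have h6 := ((MeasurePreserving.id (volume : Measure ℝ)).prod h5).comp h4
  have h7 := h6.prod (MeasurePreserving.id (volume : Measure (Fin n → ℝ)))
  set e := ((MeasurableEquiv.toLp 2 (Fin (k + 1 + n) → ℝ)).symm.trans
    ((MeasurableEquiv.piCongrLeft (fun _ : Fin (k + 1 + n) => ℝ)
    (finSumFinEquiv (m := k + 1) (n := n))).symm.trans
    ((MeasurableEquiv.sumPiEquivProdPi (fun _ : Fin (k + 1) ⊕ Fin n => ℝ)).trans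
    (((MeasurableEquiv.piFinSuccAbove (fun _ : Fin (k + 1) => ℝ) (Fin.last k)).trans
      ((MeasurableEquiv.refl ℝ).prodCongr (MeasurableEquiv.toLp 2 (Fin k → ℝ)))).prodCongr
      (MeasurableEquiv.refl (Fin n → ℝ)))))) with he
  have he' : MeasurePreserving e volume ((volume.prod volume).prod volume) :=
    h7.comp (h3.comp (h2.comp h1))
  have hset : {c : Eu (k + 1 + n) |
      WithLp.toLp 2 (fun i : Fin k => c (Fin.castAdd n i.castSucc)) ∈ A ∧
      c (Fin.castAdd n (Fin.last k)) ∈ B₀ ∧ ∀ j, c (Fin.natAdd (k + 1) j) ∈ B j} =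
      e ⁻¹' ((B₀ ×ˢ A) ×ˢ Set.univ.pi B) := by
    ext c
    have e1 : (e c).1.1 = c (Fin.castAdd n (Fin.last k)) := rfl
    have e2 : (e c).1.2 = WithLp.toLp 2 (fun i : Fin k => c (Fin.castAdd n i.castSucc)) := by
      ext i
      have h8 : (e c).1.2 i = c (Fin.castAdd n ((Fin.last k).succAbove i)) := rfl
      rw [h8, Fin.succAbove_last]
    have e3 : ∀ j, (e c).2 j = c (Fin.natAdd (k + 1) j) := fun j => rfl
    simp only [Set.mem_ofPred_eq, Set.mem_preimage, Set.mem_prod, Set.mem_univ_pi, e1, e2, e3]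
    tauto
  rw [hset, he'.measure_preimage_equiv, Measure.prod_prod, Measure.prod_prod, volume_pi,
    Measure.pi_pi, mul_comm (volume B₀)]

/-- The integrand is the Jacobian of the slice map, and the image of the slice of E lies in the
product of its coordinate projections. -/
theorem lintegral_absDet_slice_le {k n dr : ℕ} {U : Set (Eu (k + 1 + n) × Eu dr)}
    (hU : IsOpen U) {ρ : Eu (k + 1 + n) × Eu dr → ℝ} {φ : Eu (k + 1 + n) × Eu dr → Eu k}
    (hρ : ContDiffOn ℝ ∞ ρ U) (hφ : ContDiffOn ℝ ∞ φ U) {N : ℕ}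
    (hN : NondegMultiplicityLE (incidenceMap n ρ φ) (starSet (n + 1) U) N)
    {E : Set (Eu (k + 1 + n) × Eu dr)} (hE : IsClosed E) (hEU : E ⊆ U)
    (y₀ : Eu dr) (y : Fin n → Eu dr) :
    ∫⁻ x in {x | (x, y₀) ∈ E ∧ ∀ j, (x, y j) ∈ E}, ENNReal.ofReal
        (absDet (Fin.append (vecV ρ φ x y₀) fun j => gradX ρ x (y j))) ≤
      N * (volume ((fun x => φ (x, y₀)) '' {x | (x, y₀) ∈ E}) *
        volume ((fun x => ρ (x, y₀)) '' {x | (x, y₀) ∈ E}) *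
        ∏ j, volume ((fun x => ρ (x, y j)) '' {x | (x, y j) ∈ E})) := by
  set f : Eu (k + 1 + n) → Eu (k + 1 + n) :=
    fun x => WithLp.toLp 2 fun i => sliceCoord ρ φ y₀ y i x with hf
  set Ω := {x | (x, y₀) ∈ U ∧ ∀ j, (x, y j) ∈ U} with hΩ
  set A := {x | (x, y₀) ∈ E ∧ ∀ j, (x, y j) ∈ E} with hA
  have hpair : ∀ y : Eu dr, Continuous fun x : Eu (k + 1 + n) => (x, y) := fun y => by fun_prop
  have hΩo : IsOpen Ω := by
    have : Ω = {x | (x, y₀) ∈ U} ∩ ⋂ j, {x | (x, y j) ∈ U} := by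
      ext x; simp [hΩ]
    rw [this]
    exact (hU.preimage (hpair y₀)).inter (isOpen_iInter_of_finite fun j => hU.preimage (hpair _))
  have hAc : IsClosed A := by
    have : A = {x | (x, y₀) ∈ E} ∩ ⋂ j, {x | (x, y j) ∈ E} := by
      ext x; simp [hA]
    rw [this]
    exact (hE.preimage (hpair y₀)).inter (isClosed_iInter fun j => hE.preimage (hpair _))
  have hAΩ : A ⊆ Ω := fun x hx => ⟨hEU hx.1, fun j => hEU (hx.2 j)⟩
  have hcd : ∀ x ∈ Ω, ∀ i, ContDiffAt ℝ 1 (sliceCoord ρ φ y₀ y i) x := fun x hx i =>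
    sliceCoord_contDiffAt hU hρ hφ hx.1 hx.2 i
  have hfd : ContDiffOn ℝ 1 f Ω := fun x hx =>
    ((contDiffAt_piLp 2).2 fun i => hcd x hx i).contDiffWithinAt
  have hmain := lintegral_abs_det_fderiv_le_mul_image volume hΩo hfd hAc.measurableSet hAΩ
    (encard_sliceCoord_le hU hρ hφ hN y₀ y)
  have hdet : ∀ x ∈ A, ENNReal.ofReal |(fderiv ℝ f x).det| = ENNReal.ofReal
      (absDet (Fin.append (vecV ρ φ x y₀) fun j => gradX ρ x (y j))) := by
    intro x hx
    rw [hf, abs_det_fderiv_eq_absDet_gradient fun i =>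
      (hcd x (hAΩ hx) i).differentiableAt one_ne_zero]
    simp_rw [gradient_sliceCoord]
  rw [setLIntegral_congr_fun hAc.measurableSet hdet] at hmain
  refine hmain.trans ?_
  gcongr
  rw [← volume_coordinates]
  refine measure_mono ?_
  rintro _ ⟨x, hx, rfl⟩
  refine ⟨⟨x, hx.1, ?_⟩, ⟨x, hx.1, ?_⟩, fun j => ⟨x, hx.2 j, ?_⟩⟩
  · ext i
    simp [hf, sliceCoord]
  · simp [hf, sliceCoord]
  · simp [hf, sliceCoord]

/-! ### Measurability, the geometric condition and uniformity of the constant. -/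

/-- On E the partial gradient is a restriction of the full derivative, which is measurable. Outside
U there is no differentiability, hence the indicator. -/
theorem measurable_indicator_gradX {dl dr : ℕ} {U E : Set (Eu dl × Eu dr)}
    (hE : MeasurableSet E) (hEU : E ⊆ U) {ρ : Eu dl × Eu dr → ℝ}
    (hρ : ∀ p ∈ U, DifferentiableAt ℝ ρ p) :
    Measurable (E.indicator fun p => gradX ρ p.1 p.2) := by
  have h : E.indicator (fun p => gradX ρ p.1 p.2) = E.indicator fun p =>
      (InnerProductSpace.toDual ℝ (Eu dl)).symm
        ((fderiv ℝ ρ p).comp (ContinuousLinearMap.inl ℝ (Eu dl) (Eu dr))) := by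
    refine Set.indicator_congr fun p hp => ?_
    have h1 : HasFDerivAt (fun x => ρ (x, p.2)) ((fderiv ℝ ρ p).comp
        (ContinuousLinearMap.inl ℝ (Eu dl) (Eu dr))) p.1 :=
      (hρ p (hEU hp)).hasFDerivAt.comp p.1 (hasFDerivAt_prodMk_left p.1 p.2)
    rw [gradX, gradient, h1.fderiv]
  rw [h]
  refine Measurable.indicator ?_ hE
  have h2 := measurable_fderiv ℝ ρ
  refine (InnerProductSpace.toDual ℝ (Eu dl)).symm.continuous.measurable.comp ?_
  exact (ContinuousLinearMap.compL ℝ (Eu dl) (Eu dl × Eu dr) ℝ |>.flip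
    (ContinuousLinearMap.inl ℝ (Eu dl) (Eu dr))).continuous.measurable.comp h2

theorem measurable_indicator_vecV {k dl dr : ℕ} {U E : Set (Eu dl × Eu dr)}
    (hE : MeasurableSet E) (hEU : E ⊆ U) {ρ : Eu dl × Eu dr → ℝ} {φ : Eu dl × Eu dr → Eu k}
    (hρ : ∀ p ∈ U, DifferentiableAt ℝ ρ p) (hφ : ∀ p ∈ U, DifferentiableAt ℝ φ p) :
    Measurable (E.indicator fun p => vecV ρ φ p.1 p.2) := by
  refine measurable_pi_lambda _ fun i => ?_
  refine Fin.lastCases ?_ (fun i => ?_) i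
  · convert measurable_indicator_gradX hE hEU hρ using 1
    ext1 p
    by_cases hp : p ∈ E <;> simp [hp, vecV]
  · convert measurable_indicator_gradX hE hEU (ρ := fun p => φ p i)
      (fun p hp => (differentiableAt_piLp 2).1 (hφ p hp) i) using 1
    ext1 p
    by_cases hp : p ∈ E <;> simp [hp, vecV]

/-- Where the norm is at most 1 the denominator is at most 2, whatever α ≥ 0. This sublevel bound is
all that the argument takes from the geometric condition. -/
theorem GeomCondition.setLIntegral_le {k n dr : ℕ} {hn : 0 < n}
    {U E : Set (Eu (k + 1 + n) × Eu dr)} {ρ : Eu (k + 1 + n) × Eu dr → ℝ}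
    {φ : Eu (k + 1 + n) × Eu dr → Eu k} {w : Eu (k + 1 + n) × Eu dr → ℝ} {s α : ℝ} {K : ℝ≥0}
    (h : GeomCondition hn U E ρ φ w s α K) (hα : 0 ≤ α) {x : Eu (k + 1 + n)} {y₁ : Eu dr}
    (hx : (x, y₁) ∈ U) (Q : Matrix.GeneralLinearGroup (Fin n) ℝ)
    {S : Set (Eu dr)} (hS : MeasurableSet S) (hSE : S ⊆ {y | (x, y) ∈ E})
    (hSQ : ∀ y ∈ S, ‖Matrix.toEuclideanLin (Q : Matrix (Fin n) (Fin n) ℝ)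
          (projT hn (vecV ρ φ x y₁) (gradX ρ x y))‖ ≤ 1) :
    ENNReal.ofReal (|(Q : Matrix (Fin n) (Fin n) ℝ).det| ^ (s / n)) *
      ∫⁻ y in S, ‖w (x, y)‖ₑ ≤ ((2 * K : ℝ≥0) : ℝ≥0∞) := by
  rw [ENNReal.coe_mul, ENNReal.coe_ofNat]
  refine le_trans ?_ (mul_le_mul_right (h x y₁ hx Q) 2)
  rw [mul_left_comm]
  gcongr
  rw [← lintegral_const_mul' _ _ (by simp)]
  refine le_trans ?_ (lintegral_mono_set hSE)
  refine setLIntegral_mono' hS fun y hy => ?_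
  rw [← mul_div_assoc, ENNReal.le_div_iff_mul_le (by simp; left; positivity) (by simp), mul_comm]
  gcongr
  refine ENNReal.ofReal_le_of_le_toReal ?_
  rw [ENNReal.toReal_ofNat]
  have := Real.rpow_le_one (norm_nonneg _) (hSQ y hy) hα
  linarith

/-- Removes the dependence on s: the growing factor becomes 2^{(s+n)/(s'+1)} ≤ 2^{n+1}, and the
other bases are at least 1 and carry exponents at most 1. -/
theorem pointwiseConst_rpow_le {n : ℕ} (hn : 0 < n) {s s' : ℝ} (hs : 0 < s)
    (hs' : s' = s + s / n) :
    pointwiseConst n s s' ^ (((n : ℝ) + 1) * ((s' + 1) / s'))⁻¹ ≤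
      3 * 2 ^ (n + 1) * ((n + 1) ^ (n + 1) * 2 ^ n) := by
  have hn' : (0 : ℝ) < n := by exact_mod_cast hn
  have hss : s < s' := by rw [hs']; linarith [div_pos hs hn']
  have hs'0 : 0 < s' := hs.trans hss
  set t := (((n : ℝ) + 1) * ((s' + 1) / s'))⁻¹ with ht
  have ht0 : 0 ≤ t := by positivity
  have ht1 : t ≤ 1 := by
    refine inv_le_one_of_one_le₀ ?_
    have : 1 ≤ (s' + 1) / s' := by rw [one_le_div hs'0]; linarith
    nlinarith
  have hb : ∀ {a c : ℝ}, 1 ≤ a → c ≤ 1 → a ^ c ≤ a := fun ha hc => by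
    simpa using Real.rpow_le_rpow_of_exponent_le ha hc
  rw [pointwiseConst, mul_assoc, Real.mul_rpow (by positivity) (by positivity),
    ← Real.rpow_mul (by positivity)]
  have e1 : ((n : ℝ) + 1) / s' * t = 1 / (s' + 1) := by
    rw [ht]; field_simp
  rw [e1]
  gcongr
  · rw [Real.mul_rpow (by norm_num) (by positivity), ← Real.rpow_mul (by norm_num)]
    gcongr
    · refine hb (by norm_num) ?_
      rw [div_le_one (by linarith)]
      linarith
    · rw [← Real.rpow_natCast]
      refine Real.rpow_le_rpow_of_exponent_le (by norm_num) ?_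
      rw [mul_one_div, div_le_iff₀ (by linarith)]
      push_cast
      nlinarith
  · have e2 : ((n : ℝ) + 1) ^ ((n : ℝ) + 1) = (n + 1) ^ (n + 1) := by
      exact_mod_cast Real.rpow_natCast ((n : ℝ) + 1) (n + 1)
    rw [e2]
    refine hb ?_ ht1
    refine one_le_mul_of_one_le_of_one_le (one_le_pow₀ ?_) (one_le_pow₀ (by norm_num))
    linarith

/-! ### Integration in x and conclusion by duality. -/

/-- The determinantal bound integrated over all variables. -/
theorem lintegral_det_le {k n dr : ℕ} {U : Set (Eu (k + 1 + n) × Eu dr)}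
    (hU : IsOpen U) {ρ : Eu (k + 1 + n) × Eu dr → ℝ} {φ : Eu (k + 1 + n) × Eu dr → Eu k}
    (hρ : ContDiffOn ℝ ∞ ρ U) (hφ : ContDiffOn ℝ ∞ φ U) {N : ℕ}
    (hN : NondegMultiplicityLE (incidenceMap n ρ φ) (starSet (n + 1) U) N)
    {E : Set (Eu (k + 1 + n) × Eu dr)} (hE : IsClosed E) (hEU : E ⊆ U)
    {h : Eu dr → ℝ≥0∞} (hh : Measurable h) :
    ∫⁻ x, ∫⁻ y₁, E.indicator (fun p => h p.2) (x, y₁) *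
        ∫⁻ y : Fin n → Eu dr, (∏ i, E.indicator (fun p => h p.2) (x, y i)) * ENNReal.ofReal (absDet
          (Fin.append (vecV ρ φ x y₁) fun j =>
            E.indicator (fun p => gradX ρ p.1 p.2) (x, y j))) ≤
      N * (leftWidth φ E * leftWidth ρ E * leftWidth ρ E ^ n) * (∫⁻ y, h y) ^ (n + 1) := by
  set H : Eu (k + 1 + n) × Eu dr → ℝ≥0∞ := E.indicator fun p => h p.2 with hH
  set gr := E.indicator fun p => gradX ρ p.1 p.2 with hgr
  set V := E.indicator fun p => vecV ρ φ p.1 p.2 with hV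
  have hρd : ∀ p ∈ U, DifferentiableAt ℝ ρ p := fun p hp =>
    (hρ.contDiffAt (hU.mem_nhds hp)).differentiableAt (by simp)
  have hφd : ∀ p ∈ U, DifferentiableAt ℝ φ p := fun p hp =>
    (hφ.contDiffAt (hU.mem_nhds hp)).differentiableAt (by simp)
  have hHm : Measurable H := (hh.comp measurable_snd).indicator hE.measurableSet
  have hgrm : Measurable gr := measurable_indicator_gradX hE.measurableSet hEU hρd
  have hVm : Measurable V := measurable_indicator_vecV hE.measurableSet hEU hρd hφd
  obtain ⟨J, hJ⟩ : ∃ J : Eu (k + 1 + n) → Eu dr × (Fin n → Eu dr) → ℝ≥0∞, J = fun x z =>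
    ENNReal.ofReal (absDet (Fin.append (V (x, z.1)) fun j => gr (x, z.2 j))) := ⟨_, rfl⟩
  have hpair : ∀ i, Measurable fun q : Eu (k + 1 + n) × (Eu dr × (Fin n → Eu dr)) =>
      (q.1, q.2.2 i) := fun i => by fun_prop
  have hpair0 : Measurable fun q : Eu (k + 1 + n) × (Eu dr × (Fin n → Eu dr)) =>
      (q.1, q.2.1) := by fun_prop
  have hJm : Measurable (Function.uncurry J) := by
    rw [hJ]
    refine Measurable.ennreal_ofReal ?_
    have hrow : ∀ i, Measurable fun q : Eu (k + 1 + n) × (Eu dr × (Fin n → Eu dr)) =>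
        (Fin.append (V (q.1, q.2.1)) fun j => gr (q.1, q.2.2 j)) i := by
      intro i
      refine Fin.addCases (fun i => ?_) (fun i => ?_) i
      · simp only [Fin.append_left]
        exact (measurable_pi_apply i).comp (hVm.comp hpair0)
      · simp only [Fin.append_right]
        exact hgrm.comp (hpair i)
    refine Measurable.abs ?_
    simp_rw [Matrix.det_apply]
    refine Finset.measurable_sum _ fun σ _ => Measurable.const_smul ?_ _
    refine Finset.measurable_prod _ fun i _ => ?_
    have := hrow (σ i)
    simp only [Matrix.of_apply]
    fun_prop
  obtain ⟨P, hP⟩ : ∃ P : Eu (k + 1 + n) → Eu dr × (Fin n → Eu dr) → ℝ≥0∞, P = fun x z =>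
    H (x, z.1) * ∏ i, H (x, z.2 i) := ⟨_, rfl⟩
  have hPm : Measurable (Function.uncurry P) := by
    rw [hP]
    exact (hHm.comp hpair0).mul (Finset.measurable_prod _ fun i _ => hHm.comp (hpair i))
  have hPJ : Measurable (Function.uncurry fun x z => P x z * J x z) := hPm.mul hJm
  calc _ = ∫⁻ x, ∫⁻ z, P x z * J x z := by
        refine lintegral_congr fun x => ?_
        have hx : Measurable fun z => P x z * J x z := hPJ.of_uncurry_left
        rw [Measure.volume_eq_prod, lintegral_prod _ hx.aemeasurable]
        refine lintegral_congr fun y₁ => ?_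
        by_cases hy : (x, y₁) ∈ E
        · rw [← lintegral_const_mul]
          · refine lintegral_congr fun y => ?_
            simp only [hP, hJ, hV, Set.indicator_of_mem hy, mul_assoc]
          · have h1 : Measurable fun y : Fin n → Eu dr => ∏ i, H (x, y i) :=
              Finset.measurable_prod _ fun i _ => by fun_prop
            have h2 : Measurable fun y : Fin n → Eu dr => J x (y₁, y) :=
              hJm.of_uncurry_left.comp measurable_prodMk_left
            simp only [hJ, hV, Set.indicator_of_mem hy] at h2
            exact h1.mul h2
        · simp [hP, hH, Set.indicator_of_notMem hy]
    -- Tonelli puts x innermost, where the determinant is a Jacobian at fixed y-variables.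
    _ = ∫⁻ z, ∫⁻ x, P x z * J x z := lintegral_lintegral_swap hPJ.aemeasurable
    _ ≤ ∫⁻ z : Eu dr × (Fin n → Eu dr), (N * (leftWidth φ E * leftWidth ρ E * leftWidth ρ E ^ n)) *
          (h z.1 * ∏ i, h (z.2 i)) := by
        have hφ₀ : ∀ᵐ y : Eu dr, volume ((fun x => φ (x, y)) '' {x | (x, y) ∈ E}) ≤
            leftWidth φ E := ENNReal.ae_le_essSup _
        have hρ₀ : ∀ᵐ y : Eu dr, volume ((fun x => ρ (x, y)) '' {x | (x, y) ∈ E}) ≤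
            leftWidth ρ E := ENNReal.ae_le_essSup _
        have hfst : Measure.QuasiMeasurePreserving
            (Prod.fst : Eu dr × (Fin n → Eu dr) → Eu dr) volume volume :=
          Measure.quasiMeasurePreserving_fst
        have hsnd : ∀ j, Measure.QuasiMeasurePreserving
            (fun z : Eu dr × (Fin n → Eu dr) => z.2 j) volume volume := fun j =>
          (Measure.quasiMeasurePreserving_eval (fun _ : Fin n => (volume : Measure (Eu dr))) j).comp
            Measure.quasiMeasurePreserving_snd
        -- The widths are essential suprema, so their bounds are pulled back along each coordinate
        -- projection, under which preimages of null sets are null.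
        have hρ₁ := ae_all_iff.2 fun j => (hsnd j).ae hρ₀
        refine lintegral_mono_ae ?_
        filter_upwards [hfst.ae hφ₀, hfst.ae hρ₀, hρ₁] with z h1 h2 h3
        set A := {x | (x, z.1) ∈ E ∧ ∀ j, (x, z.2 j) ∈ E} with hA
        have hAm : MeasurableSet A := by
          have : A = {x | (x, z.1) ∈ E} ∩ ⋂ j, {x | (x, z.2 j) ∈ E} := by
            ext x; simp [hA]
          rw [this]
          exact (measurable_prodMk_right hE.measurableSet).inter
            (MeasurableSet.iInter fun j => measurable_prodMk_right hE.measurableSet)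
        have h4 : ∀ x, P x z * J x z = A.indicator (fun x => (h z.1 * ∏ i, h (z.2 i)) *
            ENNReal.ofReal (absDet (Fin.append (vecV ρ φ x z.1) fun j => gradX ρ x (z.2 j)))) x := by
          intro x
          by_cases hx : x ∈ A
          · rw [Set.indicator_of_mem hx]
            simp only [hP, hJ, hH, hV, hgr, Set.indicator_of_mem hx.1,
              Set.indicator_of_mem (hx.2 _)]
          · rw [Set.indicator_of_notMem hx]
            have : P x z = 0 := by
              simp only [hA, Set.mem_ofPred_eq, not_and_or, not_forall] at hx
              rcases hx with hx | ⟨j, hj⟩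
              · simp [hP, hH, Set.indicator_of_notMem hx]
              · simp only [hP]
                rw [Finset.prod_eq_zero (Finset.mem_univ j)
                  (by simp [hH, Set.indicator_of_notMem hj]), mul_zero]
            rw [this, zero_mul]
        simp_rw [h4]
        rw [lintegral_indicator hAm, lintegral_const_mul'', mul_comm]
        · gcongr
          refine (lintegral_absDet_slice_le hU hρ hφ hN hE hEU z.1 z.2).trans ?_
          gcongr
          refine (Finset.prod_le_prod' fun j _ => h3 j).trans ?_
          simp
        · have hz : Measurable fun x => J x z := hJm.of_uncurry_right
          refine hz.aemeasurable.congr ?_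
          filter_upwards [ae_restrict_mem hAm] with x hx
          simp only [hJ, hV, hgr, Set.indicator_of_mem hx.1, Set.indicator_of_mem (hx.2 _)]
    _ = _ := by
        have hm : Measurable fun y : Fin n → Eu dr => ∏ i, h (y i) := by fun_prop
        rw [lintegral_const_mul _ (by fun_prop), Measure.volume_eq_prod,
          lintegral_prod_mul hh.aemeasurable hm.aemeasurable, volume_pi, lintegral_pi_prod _ hh,
          pow_succ']

/-- The bound for the adjoint operator. -/
theorem lintegral_adjoint_rpow_le {k n dr : ℕ} (hn : 0 < n) {U : Set (Eu (k + 1 + n) × Eu dr)}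
    (hU : IsOpen U) {ρ : Eu (k + 1 + n) × Eu dr → ℝ} {φ : Eu (k + 1 + n) × Eu dr → Eu k}
    (hρ : ContDiffOn ℝ ∞ ρ U) (hφ : ContDiffOn ℝ ∞ φ U) {N : ℕ}
    (hN : NondegMultiplicityLE (incidenceMap n ρ φ) (starSet (n + 1) U) N)
    {E : Set (Eu (k + 1 + n) × Eu dr)} (hE : IsClosed E) (hEU : E ⊆ U)
    {w w' : Eu (k + 1 + n) × Eu dr → ℝ} (hw' : Measurable w')
    (hww' : w =ᵐ[volume.restrict E] w') {s s' α : ℝ} {K : ℝ≥0} (hs : 0 < s)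
    (hs' : s' = s + s / n) (hα : 0 ≤ α) (hK : GeomCondition hn U E ρ φ w s α K)
    {γ : Eu dr → ℝ≥0∞} (hγ : Measurable γ) (hγtop : ∀ y, γ y ≠ ⊤) :
    ∫⁻ x, (∫⁻ y, E.indicator (fun p => ‖w' p‖ₑ) (x, y) ^ (1 / (s' + 1)) *
        E.indicator (fun p => γ p.2) (x, y)) ^ ((n + 1) * ((s' + 1) / s')) ≤
      ENNReal.ofReal (pointwiseConst n s s') * ((2 * K : ℝ≥0) : ℝ≥0∞) ^ ((n + 1) / s') *
        (N * (leftWidth φ E * leftWidth ρ E * leftWidth ρ E ^ n) *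
          (∫⁻ y, γ y ^ ((s' + 1) / s')) ^ (n + 1)) := by
  have hn' : (0 : ℝ) < n := by exact_mod_cast hn
  have hs'0 : 0 < s' := by rw [hs']; positivity
  have hq0 : 0 < (s' + 1) / s' := by positivity
  set q := (s' + 1) / s' with hq
  have hρd : ∀ p ∈ U, DifferentiableAt ℝ ρ p := fun p hp =>
    (hρ.contDiffAt (hU.mem_nhds hp)).differentiableAt (by simp)
  have hgrm := measurable_indicator_gradX hE.measurableSet hEU hρd
  have hωm : Measurable (E.indicator fun p => ‖w' p‖ₑ) := hw'.enorm.indicator hE.measurableSet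
  have hΓm : Measurable (E.indicator fun p : Eu (k + 1 + n) × Eu dr => γ p.2) :=
    (hγ.comp measurable_snd).indicator hE.measurableSet
  have hΓq : ∀ p : Eu (k + 1 + n) × Eu dr, E.indicator (fun p => γ p.2) p ^ q =
      E.indicator (fun p => γ p.2 ^ q) p := by
    intro p
    by_cases hp : p ∈ E <;> simp [hp, ENNReal.zero_rpow_of_pos hq0]
  have hae : ∀ᵐ x, ∀ᵐ y, (x, y) ∈ E → w (x, y) = w' (x, y) := by
    have h1 := (ae_restrict_iff' hE.measurableSet).1 hww'
    rw [Measure.volume_eq_prod] at h1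
    exact Measure.ae_ae_of_ae_prod h1
  have hctop : ENNReal.ofReal (pointwiseConst n s s') * ((2 * K : ℝ≥0) : ℝ≥0∞) ^ ((n + 1) / s') ≠ ⊤ :=
    ENNReal.mul_ne_top ENNReal.ofReal_ne_top
      (ENNReal.rpow_ne_top_of_nonneg (by positivity) ENNReal.coe_ne_top)
  refine le_trans ?_ (mul_le_mul_right
    (lintegral_det_le hU hρ hφ hN hE hEU (h := fun y => γ y ^ q) (by fun_prop)) _)
  rw [← lintegral_const_mul' _ _ hctop]
  refine lintegral_mono_ae ?_
  filter_upwards [hae] with x hx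
  have hEx : MeasurableSet {y | (x, y) ∈ E} := measurable_prodMk_left hE.measurableSet
  have hvm : Measurable fun y => E.indicator (fun p => gradX ρ p.1 p.2) (x, y) :=
    hgrm.comp measurable_prodMk_left
  have hp := lintegral_rpow_le_det volume (hωm.comp (measurable_prodMk_left (x := x)))
    (hΓm.comp (measurable_prodMk_left (x := x))) ?_ hn hvm (fun y₁ => projT hn (vecV ρ φ x y₁))
    hs hs' (K := 2 * K) ?_
  · refine hp.trans (le_of_eq ?_)
    simp_rw [projT_spec]
    simp only [Function.comp_apply, ← hq, hΓq]
    rfl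
  · intro y
    by_cases hy : (x, y) ∈ E <;> simp [hy, hγtop]
  · intro y₁ hy₁ Q
    -- Only y₁ with (x, y₁) in E matter, and E ⊆ U is what makes the geometric condition available
    -- there.
    have hy₁E : (x, y₁) ∈ E := by
      by_contra h
      exact hy₁ (by simp [h])
    set S := {y | ‖Matrix.toEuclideanLin (Q : Matrix (Fin n) (Fin n) ℝ)
      (projT hn (vecV ρ φ x y₁) (E.indicator (fun p => gradX ρ p.1 p.2) (x, y)))‖ ≤ 1} with hS
    have hSm : MeasurableSet S := by
      refine measurableSet_le (Measurable.norm ?_) measurable_const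
      exact (Matrix.toEuclideanLin (Q : Matrix (Fin n) (Fin n) ℝ) ∘ₗ
        projT hn (vecV ρ φ x y₁)).toContinuousLinearMap.measurable.comp hvm
    have h1 := hK.setLIntegral_le hα (hEU hy₁E) Q (hSm.inter hEx) Set.inter_subset_right (by
      rintro y ⟨hyS, hyE⟩
      have hyE' : (x, y) ∈ E := hyE
      simpa [hS, hyE'] using hyS)
    refine le_trans (le_of_eq ?_) h1
    congr 1
    rw [Set.inter_comm, ← Measure.restrict_restrict hEx, ← lintegral_indicator hEx]
    refine lintegral_congr_ae ?_
    filter_upwards [ae_restrict_of_ae hx] with y hy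
    by_cases hyE : (x, y) ∈ E
    · simp [hyE, hy hyE]
    · simp [hyE]

theorem mainTheorem7 (k n : ℕ) (hn : 0 < n) :
    ∃ C : ℕ → ℝ≥0,
      ∀ (dr M : ℕ) (hM : k ≤ M) (U : Set (Eu (k + 1 + n) × Eu dr))
        (ρ : Eu (k + 1 + n) × Eu dr → ℝ) (φ : Eu (k + 1 + n) × Eu dr → Eu M) (N : ℕ),
        IsOpen U → ContDiffOn ℝ ∞ ρ U → ContDiffOn ℝ ∞ φ U →
        NondegMultiplicityLE (incidenceMap n ρ (truncMap hM φ)) (starSet (n + 1) U) N →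
      ∀ (E : Set (Eu (k + 1 + n) × Eu dr)) (w : Eu (k + 1 + n) × Eu dr → ℝ)
        (s α : ℝ) (K : ℝ≥0),
        IsClosed E → E ⊆ U → AEMeasurable w (volume.restrict E) → 0 < s → 0 ≤ α →
        GeomCondition hn U E ρ (truncMap hM φ) w s α K →
      ∀ (dl : ℕ) (s' p' : ℝ), dl = k + 1 + n →
        s' = ((dl : ℝ) - k) / ((dl : ℝ) - k - 1) * s →
        1 / p' = 1 - 1 / ((dl : ℝ) - k) * (s' / (s' + 1)) →
      ∀ (f : Eu (k + 1 + n) → ℂ) (g : Eu dr → ℂ), AEMeasurable f volume → AEMeasurable g volume →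
        ∫⁻ p in E, ‖w p‖ₑ ^ (1 / (s' + 1)) * ‖f p.1 * g p.2‖ₑ ≤
          C N * (leftWidth (truncMap hM φ) E ^ (s' / ((dl : ℝ) - k)) * K) ^ (1 / (s' + 1)) *
            leftWidth ρ E ^ (s' / (s' + 1)) *
            eLpNorm f (ENNReal.ofReal p') volume *
            eLpNorm g (ENNReal.ofReal ((s' + 1) / s')) volume := by
  -- The first factor bounds the root of `pointwiseConst`, the 2 comes from replacing K by 2K, and N
  -- + 1 dominates N^{1/r} because its base is at least 1 and 1/r < 1.
  refine ⟨fun N => Real.toNNReal (3 * 2 ^ (n + 1) * ((n + 1) ^ (n + 1) * 2 ^ n)) * 2 * (N + 1), ?_⟩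
  intro dr M hM U ρ φ₀ N hU hρ hφ₀ hN E w s α K hE hEU hw hs hα hK dl s' p' hdl hs' hp' f g hf hg
  set φ := truncMap hM φ₀ with hφdef
  have hφ : ContDiffOn ℝ ∞ φ U := by
    refine (contDiffOn_piLp 2).2 fun i => ?_
    exact (contDiffOn_piLp 2).1 hφ₀ (Fin.castLE hM i)
  have hn' : (0 : ℝ) < n := by exact_mod_cast hn
  have hm : (dl : ℝ) - k = n + 1 := by rw [hdl]; push_cast; ring
  rw [hm] at hs' hp' ⊢
  replace hs' : s' = s + s / n := by
    rw [hs']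
    have : (n : ℝ) + 1 - 1 = n := by ring
    rw [this]
    field_simp
  have hs'0 : 0 < s' := by rw [hs']; positivity
  set q := (s' + 1) / s' with hq
  have hq0 : 0 < q := by positivity
  have hq1 : 1 < q := by rw [hq, one_lt_div hs'0]; linarith
  set r := ((n : ℝ) + 1) * q with hr
  have hr1 : 1 < r := by nlinarith
  have hr0 : 0 < r := by positivity
  have hp'r : p'⁻¹ = 1 - r⁻¹ := by
    rw [← one_div, hp', hr, hq]
    field_simp
  have hp'inv : 0 < p'⁻¹ := by
    rw [hp'r]
    have := inv_lt_one_of_one_lt₀ hr1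
    linarith
  have hp'0 : 0 < p' := inv_pos.1 hp'inv
  have hconj : p'.HolderConjugate r := by
    rw [Real.holderConjugate_iff]
    refine ⟨?_, by rw [hp'r]; ring⟩
    rw [← inv_lt_one₀ hp'0, hp'r]
    have := inv_pos.2 hr0
    linarith
  set w' := hw.mk w with hw'
  have hw'm : Measurable w' := hw.measurable_mk
  set γ : Eu dr → ℝ≥0∞ := fun y => ‖hg.mk g y‖ₑ with hγ
  have hγm : Measurable γ := hg.measurable_mk.enorm
  set β : Eu (k + 1 + n) → ℝ≥0∞ := fun x => ‖hf.mk f x‖ₑ with hβ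
  have hβm : Measurable β := hf.measurable_mk.enorm
  have hωm : Measurable (E.indicator fun p => ‖w' p‖ₑ) := hw'm.enorm.indicator hE.measurableSet
  have hΓm : Measurable (E.indicator fun p : Eu (k + 1 + n) × Eu dr => γ p.2) :=
    (hγm.comp measurable_snd).indicator hE.measurableSet
  set X : Eu (k + 1 + n) → ℝ≥0∞ := fun x =>
    ∫⁻ y, E.indicator (fun p => ‖w' p‖ₑ) (x, y) ^ (1 / (s' + 1)) *
      E.indicator (fun p => γ p.2) (x, y) with hX
  have hprod : Measurable fun p : Eu (k + 1 + n) × Eu dr =>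
      E.indicator (fun p => ‖w' p‖ₑ) p ^ (1 / (s' + 1)) * E.indicator (fun p => γ p.2) p :=
    (hωm.pow_const _).mul hΓm
  have hXm : Measurable X := hprod.lintegral_prod_right'
  have hLHS : ∫⁻ p in E, ‖w p‖ₑ ^ (1 / (s' + 1)) * ‖f p.1 * g p.2‖ₑ = ∫⁻ x, (β * X) x := by
    have hfae : ∀ᵐ p : Eu (k + 1 + n) × Eu dr, f p.1 = hf.mk f p.1 :=
      (Measure.quasiMeasurePreserving_fst (μ := volume) (ν := volume)).ae hf.ae_eq_mk
    have hgae : ∀ᵐ p : Eu (k + 1 + n) × Eu dr, g p.2 = hg.mk g p.2 :=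
      (Measure.quasiMeasurePreserving_snd (μ := volume) (ν := volume)).ae hg.ae_eq_mk
    have hwae := (ae_restrict_iff' hE.measurableSet).1 hw.ae_eq_mk
    have h1 : ∫⁻ p in E, ‖w p‖ₑ ^ (1 / (s' + 1)) * ‖f p.1 * g p.2‖ₑ =
        ∫⁻ p : Eu (k + 1 + n) × Eu dr, β p.1 *
          (E.indicator (fun p => ‖w' p‖ₑ) p ^ (1 / (s' + 1)) *
            E.indicator (fun p => γ p.2) p) := by
      rw [← lintegral_indicator hE.measurableSet]
      refine lintegral_congr_ae ?_
      filter_upwards [hfae, hgae, hwae] with p h2 h3 h4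
      by_cases hp : p ∈ E
      · simp only [Set.indicator_of_mem hp, hβ, hγ, enorm_mul, h2, h3, h4 hp, hw']
        ring
      · simp [hp]
    rw [h1, Measure.volume_eq_prod, lintegral_prod _ (by fun_prop)]
    refine lintegral_congr fun x => ?_
    exact lintegral_const_mul (β x) (hprod.comp (measurable_prodMk_left (x := x)))
  have hadj : ∫⁻ x, X x ^ r ≤ _ := lintegral_adjoint_rpow_le hn hU hρ hφ hN hE hEU hw'm
    hw.ae_eq_mk hs hs' hα hK hγm (fun y => enorm_ne_top)
  have hfnorm : (∫⁻ x, β x ^ p') ^ (1 / p') = eLpNorm f (ENNReal.ofReal p') volume := by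
    rw [eLpNorm_congr_ae hf.ae_eq_mk, eLpNorm_eq_lintegral_rpow_enorm_toReal
      (by simpa using hp'0) ENNReal.ofReal_ne_top, ENNReal.toReal_ofReal hp'0.le]
  have hgnorm : (∫⁻ y, γ y ^ q) ^ (1 / q) = eLpNorm g (ENNReal.ofReal q) volume := by
    rw [eLpNorm_congr_ae hg.ae_eq_mk, eLpNorm_eq_lintegral_rpow_enorm_toReal
      (by simpa using hq0) ENNReal.ofReal_ne_top, ENNReal.toReal_ofReal hq0.le]
  set G := ∫⁻ y, γ y ^ q with hG
  have ht0 : 0 ≤ 1 / r := by positivity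
  -- Exponents after the r-th root: `e1` for K, `e2` for the width of φ, `e3` for the n + 1 factors
  -- of the width of ρ, `e3` with `e4` for the norm of g.
  have e1 : ((n : ℝ) + 1) / s' * (1 / r) = 1 / (s' + 1) := by rw [hr, hq]; field_simp
  have e2 : s' / ((n : ℝ) + 1) * (1 / (s' + 1)) = 1 / r := by rw [hr, hq]; field_simp
  have e3 : ((n : ℝ) + 1) * (1 / r) = s' / (s' + 1) := by rw [hr, hq]; field_simp
  have e4 : s' / (s' + 1) = 1 / q := by rw [hq]; field_simp
  have hpow : ∀ a : ℝ≥0∞, (a ^ (n + 1)) ^ (1 / r) = a ^ (s' / (s' + 1)) := by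
    intro a
    rw [← ENNReal.rpow_natCast, ← ENNReal.rpow_mul, ← e3]
    push_cast
    rfl
  have hXr : (∫⁻ x, X x ^ r) ^ (1 / r) ≤
      ENNReal.ofReal (3 * 2 ^ (n + 1) * ((n + 1) ^ (n + 1) * 2 ^ n)) * 2 * (N + 1) *
        (leftWidth φ E ^ (s' / (n + 1)) * K) ^ (1 / (s' + 1)) * leftWidth ρ E ^ (s' / (s' + 1)) *
        G ^ (1 / q) := by
    have hc : ENNReal.ofReal (pointwiseConst n s s') ^ (1 / r) ≤
        ENNReal.ofReal (3 * 2 ^ (n + 1) * ((n + 1) ^ (n + 1) * 2 ^ n)) := by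
      have h0 : 0 < pointwiseConst n s s' := by rw [pointwiseConst]; positivity
      rw [ENNReal.ofReal_rpow_of_pos h0, one_div]
      exact ENNReal.ofReal_le_ofReal (pointwiseConst_rpow_le hn hs hs')
    have h2 : (2 : ℝ≥0∞) ^ (1 / (s' + 1)) ≤ 2 := by
      have := ENNReal.rpow_le_rpow_of_exponent_le (x := 2) one_le_two
        (show 1 / (s' + 1) ≤ 1 by rw [div_le_one (by linarith)]; linarith)
      simpa using this
    have hN1 : (N : ℝ≥0∞) ^ (1 / r) ≤ N + 1 := by
      calc (N : ℝ≥0∞) ^ (1 / r) ≤ ((N : ℝ≥0∞) + 1) ^ (1 / r) := by gcongr; exact le_self_add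
        _ ≤ ((N : ℝ≥0∞) + 1) ^ (1 : ℝ) := by
          refine ENNReal.rpow_le_rpow_of_exponent_le le_add_self ?_
          rw [div_le_one hr0]
          exact hr1.le
        _ = _ := ENNReal.rpow_one _
    calc (∫⁻ x, X x ^ r) ^ (1 / r)
        ≤ (ENNReal.ofReal (pointwiseConst n s s') * ((2 * K : ℝ≥0) : ℝ≥0∞) ^ ((n + 1) / s') *
        (N * (leftWidth φ E * leftWidth ρ E * leftWidth ρ E ^ n) * G ^ (n + 1))) ^ (1 / r) := by
          gcongr
      _ = ENNReal.ofReal (pointwiseConst n s s') ^ (1 / r) *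
          ((2 : ℝ≥0∞) ^ (1 / (s' + 1)) * K ^ (1 / (s' + 1))) *
          (N ^ (1 / r) * (leftWidth φ E ^ (1 / r) * leftWidth ρ E ^ (s' / (s' + 1))) *
            G ^ (s' / (s' + 1))) := by
          rw [mul_assoc (leftWidth φ E), ← pow_succ', ENNReal.mul_rpow_of_nonneg _ _ ht0,
            ENNReal.mul_rpow_of_nonneg _ _ ht0, ENNReal.mul_rpow_of_nonneg _ _ ht0,
            ENNReal.mul_rpow_of_nonneg _ _ ht0, ENNReal.mul_rpow_of_nonneg _ _ ht0, hpow, hpow,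
            ← ENNReal.rpow_mul, e1, ENNReal.coe_mul,
            ENNReal.mul_rpow_of_nonneg _ _ (by positivity), ENNReal.coe_ofNat]
      _ ≤ ENNReal.ofReal (3 * 2 ^ (n + 1) * ((n + 1) ^ (n + 1) * 2 ^ n)) *
          (2 * K ^ (1 / (s' + 1))) *
          ((N + 1) * (leftWidth φ E ^ (1 / r) * leftWidth ρ E ^ (s' / (s' + 1))) *
            G ^ (s' / (s' + 1))) := by gcongr
      _ = _ := by
          rw [ENNReal.mul_rpow_of_nonneg _ _ (by positivity : 0 ≤ 1 / (s' + 1)),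
            ← ENNReal.rpow_mul, e2, e4]
          ring
  rw [hLHS]
  refine (ENNReal.lintegral_mul_le_Lp_mul_Lq volume hconj hβm.aemeasurable
    hXm.aemeasurable).trans ?_
  rw [hfnorm, ← hgnorm]
  refine (mul_le_mul_right hXr _).trans (le_of_eq ?_)
  simp only [ENNReal.coe_mul, ENNReal.coe_add, ENNReal.ofNNReal_toNNReal, ENNReal.coe_natCast,
    ENNReal.coe_one, ENNReal.coe_ofNat]
  ring
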